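/- Let $k$ be an algebraically closed field (of any characteristic) and let $S$ be a finite group scheme over $k$, i.e. a group object in the category of $k$-schemes whose structure morphism to $\operatorname{Spec} k$ is finite. By an $S$-module we mean a rational $S$-module, that is, a (right) comodule over the coordinate Hopf algebra $k[S]$; projectivity refers to the category of all $S$-modules. A finite-dimensional $S$-module $M$ is called endotrivial if there is a projective $S$-module $P$ with $$\operatorname{Hom}_k(M,M)\;\cong\; k\oplus P$$ as $S$-modules, where $k$ is the trivial one-dimensional module and $S$ acts on $\operatorname{Hom}_k(M,M)$ by $(g\cdot f)(m)=g\,f(g^{-1}m)$. Then for every natural number $n$ there are only finitely many isomorphism classes of endotrivial $S$-modules of dimension $n$. -/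

import Mathlib

open scoped TensorProduct

universe u

/-! ### Rational modules over an affine group scheme, as comodules over its coordinate ring -/

/-- A right comodule over a commutative Hopf algebra `H` over the field `k`. If `H = k[G]` is the
coordinate ring of an affine group scheme `G`, this is the same as a rational (left) `G`-module:
a point `g : H → R` acts on `R ⊗ V` by `v ↦ ∑ g(v₁) ⊗ v₀`, where `coact v = ∑ v₀ ⊗ v₁`. -/
structure HopfComodule (k H : Type u) [Field k] [CommRing H] [HopfAlgebra k H] where
  /-- the underlying vector space -/
  carrier : Type u
  [addCommGroup : AddCommGroup carrier]
  [module : Module k carrier]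
  /-- the coaction -/
  coact : carrier →ₗ[k] carrier ⊗[k] H
  coassoc : (TensorProduct.assoc k carrier H H).toLinearMap ∘ₗ coact.rTensor H ∘ₗ coact =
    (Coalgebra.comul (R := k) (A := H)).lTensor carrier ∘ₗ coact
  counit_coact : (TensorProduct.rid k carrier).toLinearMap ∘ₗ
    (Coalgebra.counit (R := k) (A := H)).lTensor carrier ∘ₗ coact = LinearMap.id

namespace HopfComodule

variable {k H : Type u} [Field k] [CommRing H] [HopfAlgebra k H]

instance : CoeSort (HopfComodule k H) (Type u) := ⟨carrier⟩

instance (M : HopfComodule k H) : AddCommGroup M := M.addCommGroup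

instance (M : HopfComodule k H) : Module k M := M.module

/-- A linear map is a homomorphism of comodules if it commutes with the coactions. -/
def IsHom {M N : HopfComodule k H} (f : M →ₗ[k] N) : Prop :=
  N.coact ∘ₗ f = f.rTensor H ∘ₗ M.coact

/-- Isomorphism of comodules. -/
def Iso (M N : HopfComodule k H) : Prop :=
  ∃ e : M ≃ₗ[k] N, IsHom e.toLinearMap

theorem Iso.refl (M : HopfComodule k H) : Iso M M :=
  ⟨LinearEquiv.refl k M, by simp [IsHom]⟩

theorem Iso.symm {M N : HopfComodule k H} : Iso M N → Iso N M := by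
  rintro ⟨e, he⟩
  refine ⟨e.symm, ?_⟩
  unfold IsHom at he ⊢
  have h1 : e.symm.toLinearMap.rTensor H ∘ₗ e.toLinearMap.rTensor H = LinearMap.id := by
    rw [← LinearMap.rTensor_comp]; simp
  calc M.coact ∘ₗ e.symm.toLinearMap
      = e.symm.toLinearMap.rTensor H ∘ₗ (e.toLinearMap.rTensor H ∘ₗ M.coact) ∘ₗ
          e.symm.toLinearMap := by
        rw [LinearMap.comp_assoc, ← LinearMap.comp_assoc, h1, LinearMap.id_comp]
    _ = e.symm.toLinearMap.rTensor H ∘ₗ N.coact := by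
        rw [← he, LinearMap.comp_assoc]; simp

theorem Iso.trans {M N P : HopfComodule k H} : Iso M N → Iso N P → Iso M P := by
  rintro ⟨e, he⟩ ⟨e', he'⟩
  refine ⟨e.trans e', ?_⟩
  unfold IsHom at he he' ⊢
  rw [LinearEquiv.coe_trans, LinearMap.rTensor_comp, ← LinearMap.comp_assoc, he',
    LinearMap.comp_assoc, he, LinearMap.comp_assoc]

/-- The relation of isomorphism of comodules, as a setoid. -/
def isoSetoid (k H : Type u) [Field k] [CommRing H] [HopfAlgebra k H] :
    Setoid (HopfComodule k H) :=
  ⟨Iso, Iso.refl, Iso.symm, Iso.trans⟩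

/-- The isomorphism classes of comodules. -/
def IsoClass (k H : Type u) [Field k] [CommRing H] [HopfAlgebra k H] : Type (u + 1) :=
  Quotient (isoSetoid k H)

/-- The isomorphism class of a comodule. -/
def isoClass (M : HopfComodule k H) : IsoClass k H :=
  Quotient.mk (isoSetoid k H) M

/-- Projective objects of the category of all comodules: homomorphisms to the target of a
surjective homomorphism lift to its source. -/
def IsProjective (P : HopfComodule k H) : Prop :=
  ∀ (M N : HopfComodule k H) (p : M →ₗ[k] N) (f : P →ₗ[k] N), IsHom p → Function.Surjective p →
    IsHom f → ∃ g : P →ₗ[k] M, IsHom g ∧ p ∘ₗ g = f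

variable (k H) in
/-- The trivial one-dimensional comodule `k`, with coaction `x ↦ x ⊗ 1`. -/
noncomputable abbrev trivial : HopfComodule k H where
  carrier := k
  coact := (TensorProduct.mk k k H).flip 1
  coassoc := by
    ext
    simp [Algebra.TensorProduct.one_def]
  counit_coact := by
    ext
    simp

/-- The direct sum of two comodules. -/
noncomputable abbrev directSum (M N : HopfComodule k H) : HopfComodule k H where
  carrier := M × N
  coact := ((LinearMap.inl k M N).rTensor H ∘ₗ M.coact).coprod
    ((LinearMap.inr k M N).rTensor H ∘ₗ N.coact)
  coassoc := by
    apply LinearMap.prod_ext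
    · rw [LinearMap.comp_assoc, LinearMap.comp_assoc, LinearMap.comp_assoc, LinearMap.coprod_inl,
        ← LinearMap.comp_assoc M.coact, ← LinearMap.rTensor_comp,
        LinearMap.coprod_inl]
      have h := congrArg (fun t ↦ (LinearMap.inl k M N).rTensor (H ⊗[k] H) ∘ₗ t) M.coassoc
      refine Eq.trans (Eq.trans ?_ h) ?_
      · rw [LinearMap.rTensor_comp]
        simp only [← LinearMap.comp_assoc]
        congr 2
        ext; simp
      · simp only [← LinearMap.comp_assoc]
        congr 1
        ext; simp
    · rw [LinearMap.comp_assoc, LinearMap.comp_assoc, LinearMap.comp_assoc, LinearMap.coprod_inr,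
        ← LinearMap.comp_assoc N.coact, ← LinearMap.rTensor_comp,
        LinearMap.coprod_inr]
      have h := congrArg (fun t ↦ (LinearMap.inr k M N).rTensor (H ⊗[k] H) ∘ₗ t) N.coassoc
      refine Eq.trans (Eq.trans ?_ h) ?_
      · rw [LinearMap.rTensor_comp]
        simp only [← LinearMap.comp_assoc]
        congr 2
        ext; simp
      · simp only [← LinearMap.comp_assoc]
        congr 1
        ext; simp
  counit_coact := by
    apply LinearMap.prod_ext
    · rw [LinearMap.comp_assoc, LinearMap.comp_assoc, LinearMap.coprod_inl]
      have h := congrArg (fun t ↦ LinearMap.inl k M N ∘ₗ t) M.counit_coact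
      refine Eq.trans ?_ h
      simp only [← LinearMap.comp_assoc]
      congr 1
      ext <;> simp
    · rw [LinearMap.comp_assoc, LinearMap.comp_assoc, LinearMap.coprod_inr]
      have h := congrArg (fun t ↦ LinearMap.inr k M N ∘ₗ t) N.counit_coact
      refine Eq.trans ?_ h
      simp only [← LinearMap.comp_assoc]
      congr 1
      ext <;> simp

/-! ### The comodule of linear maps -/

/-- `∑ Δ(S h) = ∑ S(h₂) ⊗ S(h₁)`. -/
theorem comul_antipode (h : H) :
    Coalgebra.comul (R := k) (HopfAlgebra.antipode k h) =
      TensorProduct.map (HopfAlgebra.antipode k) (HopfAlgebra.antipode k)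
        (TensorProduct.comm k H H (Coalgebra.comul h)) := by
  let a : WithConv (H →ₐ[k] H ⊗[k] H) := .toConv Algebra.TensorProduct.includeLeft
  let b : WithConv (H →ₐ[k] H ⊗[k] H) := .toConv Algebra.TensorProduct.includeRight
  have hab : a * b = .toConv (Bialgebra.comulAlgHom k H) := by
    ext x
    rw [AlgHom.convMul_apply]
    change _ = Coalgebra.comul (R := k) x
    generalize Coalgebra.comul (R := k) x = y
    induction y with
    | zero => simp
    | tmul p q => simp [a, b]
    | add p q hp hq => rw [map_add, hp, hq]
  have hinv : (a * b)⁻¹ = b⁻¹ * a⁻¹ := mul_inv_rev a b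
  rw [hab] at hinv
  have h1 := DFunLike.congr_fun (congrArg WithConv.ofConv hinv) h
  refine Eq.trans h1 ?_
  refine (AlgHom.convMul_apply _ _ _).trans ?_
  generalize Coalgebra.comul (R := k) h = y
  induction y with
  | zero => simp
  | tmul p q =>
    simp only [Algebra.TensorProduct.lift_tmul, TensorProduct.comm_tmul, TensorProduct.map_tmul]
    change (1 ⊗ₜ[k] HopfAlgebra.antipode k p) * (HopfAlgebra.antipode k q ⊗ₜ[k] 1) = _
    simp
  | add p q hp hq => simp only [map_add, hp, hq]

/-- The map `V ⊗ H → V ⊗ H`, `v ⊗ h ↦ ∑ v₀ ⊗ v₁ S(h)`. -/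
noncomputable def twist (N : HopfComodule k H) : N ⊗[k] H →ₗ[k] N ⊗[k] H :=
  (LinearMap.mul' k H).lTensor N ∘ₗ (TensorProduct.assoc k N H H).toLinearMap ∘ₗ
    TensorProduct.map N.coact (HopfAlgebra.antipode k)

/-- The map `f ↦ (m ↦ ∑ f(m₀)₀ ⊗ f(m₀)₁ S(m₁))`, which is the coaction on `Hom(M, N)` that
corresponds to the action `(g • f)(m) = g • f (g⁻¹ • m)`. -/
noncomputable def homCoactAux (M N : HopfComodule k H) :
    (M →ₗ[k] N) →ₗ[k] (M →ₗ[k] N ⊗[k] H) where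
  toFun f := N.twist ∘ₗ f.rTensor H ∘ₗ M.coact
  map_add' f g := by
    rw [LinearMap.rTensor_add, LinearMap.add_comp, LinearMap.comp_add]
  map_smul' c f := by
    rw [LinearMap.rTensor_smul, LinearMap.smul_comp, LinearMap.comp_smul, RingHom.id_apply]


/-- The vector space isomorphism `Hom(M, N) ⊗ Q ≃ Hom(M, N ⊗ Q)` for finite-dimensional `M`. -/
noncomputable abbrev homTensorEquiv (M N : HopfComodule k H) [Module.Finite k M]
    (Q : Type u) [AddCommGroup Q] [Module k Q] :
    (M →ₗ[k] N) ⊗[k] Q ≃ₗ[k] (M →ₗ[k] N ⊗[k] Q) :=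
  rTensorHomEquivHomRTensor k M N Q

theorem homTensorEquiv_tmul (M N : HopfComodule k H) [Module.Finite k M]
    (Q : Type u) [AddCommGroup Q] [Module k Q] (f : M →ₗ[k] N) (q : Q) (m : M) :
    homTensorEquiv M N Q (f ⊗ₜ q) m = f m ⊗ₜ q := by
  simp [homTensorEquiv]

theorem homTensorEquiv_lTensor (M N : HopfComodule k H) [Module.Finite k M]
    {Q Q' : Type u} [AddCommGroup Q] [Module k Q] [AddCommGroup Q'] [Module k Q']
    (t : Q →ₗ[k] Q') (x : (M →ₗ[k] N) ⊗[k] Q) (m : M) :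
    homTensorEquiv M N Q' (t.lTensor (M →ₗ[k] N) x) m =
      t.lTensor N (homTensorEquiv M N Q x m) := by
  induction x with
  | zero => simp
  | tmul f q => rw [LinearMap.lTensor_tmul, homTensorEquiv_tmul, homTensorEquiv_tmul,
      LinearMap.lTensor_tmul]
  | add x y hx hy => simp only [map_add, LinearMap.add_apply, hx, hy]

theorem homTensorEquiv_assoc (M N : HopfComodule k H) [Module.Finite k M]
    (x : (M →ₗ[k] N) ⊗[k] H) (h : H) (m : M) :
    homTensorEquiv M N (H ⊗[k] H) (TensorProduct.assoc k (M →ₗ[k] N) H H (x ⊗ₜ h)) m =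
      TensorProduct.assoc k N H H (homTensorEquiv M N H x m ⊗ₜ h) := by
  induction x with
  | zero => simp
  | tmul f q => rw [TensorProduct.assoc_tmul, homTensorEquiv_tmul, homTensorEquiv_tmul,
      TensorProduct.assoc_tmul]
  | add x y hx hy => simp only [map_add, LinearMap.add_apply, TensorProduct.add_tmul, hx, hy]

/-- `(v ⊗ h) ⊗ a ↦ ∑ v₀ ⊗ (v₁ S(a) ⊗ h)`. -/
noncomputable def twist₂ (N : HopfComodule k H) :
    (N ⊗[k] H) ⊗[k] H →ₗ[k] N ⊗[k] (H ⊗[k] H) :=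
  (TensorProduct.assoc k N H H).toLinearMap ∘ₗ N.twist.rTensor H ∘ₗ
    (TensorProduct.rightComm k N H H).toLinearMap

theorem twist₂_tmul (N : HopfComodule k H) (v : N) (h a : H) :
    N.twist₂ ((v ⊗ₜ h) ⊗ₜ a) = TensorProduct.assoc k N H H (N.twist (v ⊗ₜ a) ⊗ₜ h) := by
  simp [twist₂]

theorem twist_tmul (N : HopfComodule k H) (v : N) (h : H) :
    N.twist (v ⊗ₜ h) =
      (LinearMap.mulRight k (HopfAlgebra.antipode k h)).lTensor N (N.coact v) := by
  simp only [twist, LinearMap.comp_apply, TensorProduct.map_tmul]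
  generalize N.coact v = y
  induction y with
  | zero => simp
  | tmul p q => simp
  | add x y hx hy => simp only [map_add, TensorProduct.add_tmul, hx, hy]

theorem twist₂_twist (N : HopfComodule k H) (v : N) (b c : H) :
    N.twist₂ (N.twist (v ⊗ₜ b) ⊗ₜ c) =
      (LinearMap.mulRight k
        (HopfAlgebra.antipode k c ⊗ₜ[k] HopfAlgebra.antipode k b)).lTensor N
        (TensorProduct.assoc k N H H (N.coact.rTensor H (N.coact v))) := by
  rw [twist_tmul]
  generalize N.coact v = y
  induction y with
  | zero => simp
  | tmul p q =>
    rw [LinearMap.lTensor_tmul, twist₂_tmul, twist_tmul, LinearMap.rTensor_tmul]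
    generalize N.coact p = z
    induction z with
    | zero => simp
    | tmul r s => simp
    | add x y hx hy => simp only [map_add, TensorProduct.add_tmul, hx, hy]
  | add x y hx hy => simp only [map_add, TensorProduct.add_tmul, hx, hy]

theorem lTensor_comul_twist (N : HopfComodule k H) (y : N ⊗[k] H) :
    (Coalgebra.comul (R := k) (A := H)).lTensor N (N.twist y) =
      N.twist₂ (N.twist.rTensor H ((TensorProduct.assoc k N H H).symm
        ((Coalgebra.comul (R := k) (A := H)).lTensor N y))) := by
  induction y with
  | zero => simp
  | add x y hx hy => simp only [map_add, hx, hy]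
  | tmul v h =>
    have hR : ∀ w : H ⊗[k] H,
        N.twist₂ (N.twist.rTensor H ((TensorProduct.assoc k N H H).symm (v ⊗ₜ w))) =
        (LinearMap.mulRight k (TensorProduct.map (HopfAlgebra.antipode k)
          (HopfAlgebra.antipode k) (TensorProduct.comm k H H w))).lTensor N
          (TensorProduct.assoc k N H H (N.coact.rTensor H (N.coact v))) := by
      intro w
      induction w with
      | zero =>
        have : LinearMap.mulRight k (0 : H ⊗[k] H) = 0 := by ext; simp
        simp [this]
      | tmul b c => simp [twist₂_twist]
      | add x y hx hy =>
        have : ∀ p q : H ⊗[k] H, LinearMap.mulRight k (p + q) =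
            LinearMap.mulRight k p + LinearMap.mulRight k q := by
          intro p q
          refine LinearMap.ext fun z ↦ ?_
          simp [mul_add]
        simp only [TensorProduct.tmul_add, map_add, hx, hy, this, LinearMap.lTensor_add,
          LinearMap.add_apply]
    rw [LinearMap.lTensor_tmul, hR, ← comul_antipode, twist_tmul]
    have hc : TensorProduct.assoc k N H H (N.coact.rTensor H (N.coact v)) =
        (Coalgebra.comul (R := k) (A := H)).lTensor N (N.coact v) :=
      LinearMap.congr_fun N.coassoc v
    rw [hc]
    generalize N.coact v = y
    induction y with
    | zero => simp
    | tmul r s => simp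
    | add x y hx hy => simp only [map_add, hx, hy]

/-- The comodule `Hom(M, N)` of all linear maps `M → N`, for finite-dimensional `M`. -/
noncomputable abbrev hom (M N : HopfComodule k H) [Module.Finite k M] : HopfComodule k H where
  carrier := M →ₗ[k] N
  coact := (homTensorEquiv M N H).symm.toLinearMap ∘ₗ homCoactAux M N
  coassoc := by
    refine LinearMap.ext fun f ↦ (homTensorEquiv M N (H ⊗[k] H)).injective ?_
    refine LinearMap.ext fun m ↦ ?_
    simp only [LinearMap.comp_apply, LinearEquiv.coe_coe]
    rw [homTensorEquiv_lTensor, LinearEquiv.apply_symm_apply]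
    have hA : ∀ x : (M →ₗ[k] N) ⊗[k] H,
        homTensorEquiv M N (H ⊗[k] H) (TensorProduct.assoc k (M →ₗ[k] N) H H
          (((homTensorEquiv M N H).symm.toLinearMap ∘ₗ homCoactAux M N).rTensor H x)) m =
        N.twist₂ ((homTensorEquiv M N H x).rTensor H (M.coact m)) := by
      intro x
      induction x with
      | zero => simp
      | add x y hx hy =>
        simp only [map_add, LinearMap.add_apply, LinearMap.rTensor_add, hx, hy]
      | tmul f h =>
        rw [LinearMap.rTensor_tmul, homTensorEquiv_assoc, LinearMap.comp_apply,
          LinearEquiv.coe_coe, LinearEquiv.apply_symm_apply]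
        simp only [homCoactAux, LinearMap.coe_mk, AddHom.coe_mk, LinearMap.comp_apply]
        generalize M.coact m = y
        induction y with
        | zero => simp
        | add x y hx hy => simp only [map_add, TensorProduct.add_tmul, hx, hy]
        | tmul p q =>
          rw [LinearMap.rTensor_tmul, LinearMap.rTensor_tmul, homTensorEquiv_tmul, twist₂_tmul]
    rw [hA, LinearEquiv.apply_symm_apply]
    simp only [homCoactAux, LinearMap.coe_mk, AddHom.coe_mk, LinearMap.comp_apply]
    rw [lTensor_comul_twist]
    congr 1
    have hc : M.coact.rTensor H (M.coact m) = (TensorProduct.assoc k M H H).symm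
        ((Coalgebra.comul (R := k) (A := H)).lTensor M (M.coact m)) := by
      rw [LinearEquiv.eq_symm_apply]
      exact LinearMap.congr_fun M.coassoc m
    rw [LinearMap.rTensor_comp, LinearMap.rTensor_comp, LinearMap.comp_apply,
      LinearMap.comp_apply, hc]
    congr 1
    generalize M.coact m = y
    induction y with
    | zero => simp
    | add x y hx hy => simp only [map_add, hx, hy]
    | tmul p q =>
      rw [LinearMap.lTensor_tmul, LinearMap.rTensor_tmul, LinearMap.lTensor_tmul]
      generalize Coalgebra.comul (R := k) q = z
      induction z with
      | zero => simp
      | add x y hx hy => simp only [map_add, TensorProduct.tmul_add, hx, hy]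
      | tmul p q => simp
  counit_coact := by
    refine LinearMap.ext fun f ↦ LinearMap.ext fun m ↦ ?_
    have hr : ∀ x : (M →ₗ[k] N) ⊗[k] k, TensorProduct.rid k (M →ₗ[k] N) x m =
        TensorProduct.rid k N (homTensorEquiv M N k x m) := by
      intro x
      induction x with
      | zero => simp
      | add x y hx hy => simp only [map_add, LinearMap.add_apply, hx, hy]
      | tmul f c => rw [homTensorEquiv_tmul]; simp
    simp only [LinearMap.comp_apply, LinearEquiv.coe_coe, LinearMap.id_apply]
    rw [hr, homTensorEquiv_lTensor, LinearEquiv.apply_symm_apply]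
    simp only [homCoactAux, LinearMap.coe_mk, AddHom.coe_mk, LinearMap.comp_apply]
    have ht : ∀ y : N ⊗[k] H, TensorProduct.rid k N
        ((Coalgebra.counit (R := k) (A := H)).lTensor N (N.twist y)) =
        TensorProduct.rid k N ((Coalgebra.counit (R := k) (A := H)).lTensor N y) := by
      intro y
      induction y with
      | zero => simp
      | add x y hx hy => simp only [map_add, hx, hy]
      | tmul v h =>
        have hv : TensorProduct.rid k N
            ((Coalgebra.counit (R := k) (A := H)).lTensor N (N.coact v)) = v :=
          LinearMap.congr_fun N.counit_coact v
        rw [twist_tmul, LinearMap.lTensor_tmul, TensorProduct.rid_tmul]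
        conv_rhs => rw [← hv]
        generalize N.coact v = y
        induction y with
        | zero => simp
        | add x y hx hy => simp only [map_add, smul_add, hx, hy]
        | tmul r s => simp [mul_comm, mul_smul]
    rw [ht]
    have hm : TensorProduct.rid k M
        ((Coalgebra.counit (R := k) (A := H)).lTensor M (M.coact m)) = m :=
      LinearMap.congr_fun M.counit_coact m
    conv_rhs => rw [← hm]
    generalize M.coact m = y
    induction y with
    | zero => simp
    | add x y hx hy => simp only [map_add, hx, hy]
    | tmul r s => simp

/-- A finite-dimensional comodule `M` is endotrivial if `Hom(M, M)` is isomorphic to `k ⊕ P` for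
some projective comodule `P`. -/
def IsEndotrivial (M : HopfComodule k H) [Module.Finite k M] : Prop :=
  ∃ P : HopfComodule k H, IsProjective P ∧ Iso (hom M M) (directSum (trivial k H) P)

end HopfComodule

/-! ### Finite group schemes -/

section

open AlgebraicGeometry CategoryTheory

/-- The Hopf algebra of global functions on an affine group scheme `G` over `Spec R`. -/
noncomputable abbrev globalSectionsHopfAlgebra (R : CommRingCat.{u}) (G : Scheme.{u})
    [G.Over (Spec R)] [GrpObj (G.asOver (Spec R))] [IsAffine G] : HopfAlgebra R Γ(G, ⊤) :=
  inferInstance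

/-- A finite group scheme over a field `k`: a group object in the category of schemes over
`Spec k` whose structure morphism is finite. -/
structure FiniteGroupScheme (k : Type u) [Field k] where
  /-- the underlying scheme -/
  scheme : Scheme.{u}
  [isOver : scheme.Over (Spec (CommRingCat.of k))]
  [isGrp : GrpObj (scheme.asOver (Spec (CommRingCat.of k)))]
  [isFinite : IsFinite (scheme ↘ Spec (CommRingCat.of k))]

namespace FiniteGroupScheme

variable {k : Type u} [Field k]

attribute [instance] isOver isGrp isFinite

instance (S : FiniteGroupScheme k) : IsAffine S.scheme :=
  isAffine_of_isAffineHom (S.scheme ↘ Spec (CommRingCat.of k))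

/-- The coordinate ring `k[S]`. -/
abbrev CoordinateRing (S : FiniteGroupScheme k) : Type u := Γ(S.scheme, ⊤)

/-- The Hopf algebra structure of `k[S]` that is given by the group structure of `S`. -/
noncomputable instance (S : FiniteGroupScheme k) : HopfAlgebra k S.CoordinateRing :=
  globalSectionsHopfAlgebra (CommRingCat.of k) S.scheme

/-- (Rational) `S`-modules, i.e. comodules over `k[S]`. -/
abbrev Rep (S : FiniteGroupScheme k) : Type (u + 1) := HopfComodule k S.CoordinateRing

end FiniteGroupScheme

end

set_option linter.unusedSectionVars false

/-! Fix a basis of each module, so that a module of dimension `n` becomes an `n × n` matrix over the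
coordinate ring, that is, a point of a finite-dimensional affine space. Let `M` be endotrivial, with
`M ⊗ M* ≅ k ⊕ P`. The modules `S` of the same dimension for which `S ⊗ M*` still has `P` as a direct
summand contain all those in a principal open neighbourhood of `M` (`FProj.exists_polynomial`). This
works because a homomorphism out of a projective can be built from an arbitrary linear map by
passing through a free module, and because projectives are also injective
(`FProj.exists_retraction`), so an injective homomorphism from `P` splits.

For such `S` the complement of `P` in `S ⊗ M*` is one-dimensional, hence given by a group-like
element, and there are finitely many of these (`finite_isGroupLikeElem`). If `S` and `T` give the
same group-like element, then `S ⊗ M* ≅ T ⊗ M*`. Tensoring with `M` makes `S` and `T` isomorphic up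
to maps that factor through projectives (`MatEndotrivial.exists_stable`).

To pass from stable to actual isomorphism, stratify by the dimension `d` of a largest projective
summand and shrink the neighbourhood so that `S` and `T` both contain the same projective of
dimension `d`. Its complement in `S` has no projective summand, so a Fitting argument
(`ProjFree.isUnit`) turns the stable isomorphism into an isomorphism of complements
(`matIso_of_stable`). By Hilbert's basis theorem finitely many neighbourhoods cover each stratum
(`exists_finite_subcover`), which leaves finitely many classes. -/

namespace HopfComodule

open Matrix

variable {k H : Type u} [Field k] [CommRing H] [HopfAlgebra k H]

/-! ### Comodules and homomorphisms as matrices -/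

/-- The base change of a matrix over `k` to a matrix over the `k`-algebra `H`. -/
def baseMat (H : Type u) [CommRing H] [HopfAlgebra k H] {ι κ : Type*} (F : Matrix ι κ k) :
    Matrix ι κ H :=
  F.map (algebraMap k H)

section baseMat

variable {ι κ μ ν : Type*}

@[simp] theorem baseMat_apply (F : Matrix ι κ k) (i : ι) (j : κ) :
    baseMat H F i j = algebraMap k H (F i j) := rfl

theorem baseMat_mul [Fintype κ] (F : Matrix ι κ k) (G : Matrix κ μ k) :
    baseMat H (F * G) = baseMat H F * baseMat H G :=
  Matrix.map_mul

@[simp] theorem baseMat_one [DecidableEq ι] : baseMat H (1 : Matrix ι ι k) = 1 :=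
  Matrix.map_one _ (map_zero _) (map_one _)

@[simp] theorem baseMat_zero : baseMat H (0 : Matrix ι κ k) = 0 := by
  ext; simp

theorem baseMat_add (F G : Matrix ι κ k) : baseMat H (F + G) = baseMat H F + baseMat H G := by
  ext; simp

theorem baseMat_sub (F G : Matrix ι κ k) : baseMat H (F - G) = baseMat H F - baseMat H G := by
  ext; simp

theorem baseMat_smul (c : k) (F : Matrix ι κ k) :
    baseMat H (c • F) = algebraMap k H c • baseMat H F := by
  ext; simp

theorem baseMat_transpose (F : Matrix ι κ k) : baseMat H Fᵀ = (baseMat H F)ᵀ := rfl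

theorem baseMat_kronecker (F : Matrix ι κ k) (G : Matrix μ ν k) :
    baseMat H (kroneckerMap (· * ·) F G) = kroneckerMap (· * ·) (baseMat H F) (baseMat H G) := by
  ext; simp

theorem baseMat_map {B : Type*} [Semiring B] [Algebra k B] (F : Matrix ι κ k) (f : H →ₐ[k] B) :
    (baseMat H F).map f = F.map (algebraMap k B) := by
  ext; simp

end baseMat

/-- The matrix of matrix coefficients of a finite-dimensional right comodule with a basis: a
matrix with `Δ(rᵢⱼ) = ∑ rᵢₗ ⊗ rₗⱼ` and `ε(rᵢⱼ) = δᵢⱼ`. -/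
structure IsCorep (k : Type u) {H : Type u} [Field k] [CommRing H] [HopfAlgebra k H] {ι : Type*}
    [Fintype ι] [DecidableEq ι] (r : Matrix ι ι H) : Prop where
  comul : ∀ i j, Coalgebra.comul (R := k) (r i j) = ∑ l, r i l ⊗ₜ[k] r l j
  counit : ∀ i j, Coalgebra.counit (R := k) (r i j) = (1 : Matrix ι ι k) i j

/-- The matrix `F` over `k` is a homomorphism between the comodules with coefficient matrices
`r` and `s`. -/
def Intertwines {ι κ : Type*} [Fintype ι] [Fintype κ] (F : Matrix κ ι k) (r : Matrix ι ι H)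
    (s : Matrix κ κ H) : Prop :=
  baseMat H F * r = s * baseMat H F

/-- The coefficient matrix of the dual comodule. -/
noncomputable def dualMat (k : Type u) {H : Type u} [Field k] [CommRing H] [HopfAlgebra k H]
    {ι : Type*} (r : Matrix ι ι H) : Matrix ι ι H :=
  (r.map (HopfAlgebra.antipode k))ᵀ

/-- The coefficient matrix of the tensor product. -/
abbrev tensMat {ι κ : Type*} (r : Matrix ι ι H) (s : Matrix κ κ H) : Matrix (ι × κ) (ι × κ) H :=
  kroneckerMap (· * ·) r s

namespace Intertwines

variable {ι κ μ ν : Type*} [Fintype ι] [Fintype κ] [Fintype μ] [Fintype ν]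
  {r : Matrix ι ι H} {s : Matrix κ κ H} {t : Matrix μ μ H} {v : Matrix ν ν H}

theorem comp {G : Matrix μ κ k} {F : Matrix κ ι k} (hG : Intertwines G s t)
    (hF : Intertwines F r s) : Intertwines (G * F) r t := by
  unfold Intertwines at *
  rw [baseMat_mul, Matrix.mul_assoc, hF, ← Matrix.mul_assoc, hG, Matrix.mul_assoc]

theorem one [DecidableEq ι] : Intertwines (1 : Matrix ι ι k) r r := by
  simp [Intertwines]

theorem zero : Intertwines (0 : Matrix κ ι k) r s := by
  simp [Intertwines]

theorem add {F G : Matrix κ ι k} (hF : Intertwines F r s) (hG : Intertwines G r s) :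
    Intertwines (F + G) r s := by
  unfold Intertwines at *
  rw [baseMat_add, Matrix.add_mul, hF, hG, Matrix.mul_add]

theorem sub {F G : Matrix κ ι k} (hF : Intertwines F r s) (hG : Intertwines G r s) :
    Intertwines (F - G) r s := by
  unfold Intertwines at *
  rw [baseMat_sub, Matrix.sub_mul, hF, hG, Matrix.mul_sub]

theorem smul {F : Matrix κ ι k} (c : k) (hF : Intertwines F r s) : Intertwines (c • F) r s := by
  unfold Intertwines at *
  rw [baseMat_smul, Matrix.smul_mul, hF, Matrix.mul_smul]

theorem aeval [DecidableEq ι] {F : Matrix ι ι k} (hF : Intertwines F r r)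
    (p : Polynomial k) : Intertwines (Polynomial.aeval F p) r r := by
  induction p using Polynomial.induction_on with
  | C a => simpa [Algebra.algebraMap_eq_smul_one] using one.smul a
  | add p q hp hq => simpa using hp.add hq
  | monomial n a h =>
    have : (Polynomial.aeval F) (Polynomial.C a * Polynomial.X ^ (n + 1)) =
        (Polynomial.aeval F) (Polynomial.C a * Polynomial.X ^ n) * F := by
      simp [pow_succ, mul_assoc]
    rw [this]
    exact h.comp hF

theorem kronecker {F : Matrix κ ι k} {G : Matrix ν μ k} (hF : Intertwines F r s)
    (hG : Intertwines G t v) :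
    Intertwines (kroneckerMap (· * ·) F G) (tensMat r t) (tensMat s v) := by
  unfold Intertwines at *
  rw [baseMat_kronecker, ← Matrix.mul_kronecker_mul, ← Matrix.mul_kronecker_mul, hF, hG]

theorem submatrix {ι' κ' : Type*} [Fintype ι'] [Fintype κ'] {F : Matrix κ ι k}
    (hF : Intertwines F r s) (e : κ' ≃ κ) (f : ι' ≃ ι) :
    Intertwines (F.submatrix e f) (r.submatrix f f) (s.submatrix e e) := by
  unfold Intertwines at *
  have : baseMat H (F.submatrix e f) = (baseMat H F).submatrix e f := rfl
  rw [this, Matrix.submatrix_mul_equiv, Matrix.submatrix_mul_equiv, hF]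

end Intertwines

namespace IsCorep

variable {ι κ : Type*} [Fintype ι] [Fintype κ] [DecidableEq ι] [DecidableEq κ]
  {r : Matrix ι ι H} {s : Matrix κ κ H}

theorem antipode_mul (hr : IsCorep k r) : r.map (HopfAlgebra.antipode k) * r = 1 := by
  ext i j
  have h := HopfAlgebra.mul_antipode_rTensor_comul_apply (R := k) (r i j)
  rw [hr.comul, hr.counit] at h
  simp only [map_sum, LinearMap.rTensor_tmul, LinearMap.mul'_apply] at h
  rw [Matrix.mul_apply]
  simp only [Matrix.map_apply]
  rw [h, Matrix.one_apply, Matrix.one_apply]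
  split_ifs <;> simp

theorem mul_antipode (hr : IsCorep k r) : r * r.map (HopfAlgebra.antipode k) = 1 :=
  mul_eq_one_comm.1 hr.antipode_mul

theorem map_counit (hr : IsCorep k r) : r.map (Coalgebra.counit (R := k)) = 1 := by
  ext i j
  exact hr.counit i j

/-- In this form the comultiplication axiom is a matrix identity over `H ⊗ H`, so summands can be
treated by matrix algebra instead of sums of tensors. -/
theorem map_comul (hr : IsCorep k r) : r.map (Bialgebra.comulAlgHom k H) =
    r.map (Algebra.TensorProduct.includeLeft : H →ₐ[k] H ⊗[k] H) *
      r.map (Algebra.TensorProduct.includeRight : H →ₐ[k] H ⊗[k] H) := by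
  ext i j
  simp [Matrix.mul_apply, hr.comul]

theorem of_map (h : r.map (Bialgebra.comulAlgHom k H) =
    r.map (Algebra.TensorProduct.includeLeft : H →ₐ[k] H ⊗[k] H) *
      r.map (Algebra.TensorProduct.includeRight : H →ₐ[k] H ⊗[k] H))
    (h' : r.map (Bialgebra.counitAlgHom k H) = 1) : IsCorep k r where
  comul i j := by
    simpa [Matrix.mul_apply] using congrFun (congrFun h i) j
  counit i j := congrFun (congrFun h' i) j

theorem dual (hr : IsCorep k r) : IsCorep k (dualMat k r) where
  comul i j := by
    simp only [dualMat, Matrix.transpose_apply, Matrix.map_apply]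
    rw [comul_antipode, hr.comul]
    simp
  counit i j := by
    simp only [dualMat, Matrix.transpose_apply, Matrix.map_apply]
    rw [HopfAlgebra.counit_antipode, hr.counit, Matrix.one_apply, Matrix.one_apply]
    simp [eq_comm]

theorem tensor (hr : IsCorep k r) (hs : IsCorep k s) : IsCorep k (tensMat r s) where
  comul i j := by
    simp only [tensMat, Matrix.kroneckerMap_apply]
    rw [Bialgebra.comul_mul, hr.comul, hs.comul, Finset.sum_mul_sum, Fintype.sum_prod_type]
    simp [Algebra.TensorProduct.tmul_mul_tmul]
  counit i j := by
    simp only [tensMat, Matrix.kroneckerMap_apply]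
    rw [Bialgebra.counit_mul, hr.counit, hs.counit]
    simp only [Matrix.one_apply, Prod.ext_iff]
    split_ifs <;> simp_all

theorem one : IsCorep k (1 : Matrix ι ι H) := by
  refine of_map ?_ (Matrix.map_one _ (map_zero _) (map_one _))
  rw [Matrix.map_one _ (map_zero _) (map_one _), Matrix.map_one _ (map_zero _) (map_one _),
    Matrix.map_one _ (map_zero _) (map_one _), Matrix.mul_one]

theorem directSum (hr : IsCorep k r) (hs : IsCorep k s) :
    IsCorep k (Matrix.fromBlocks r 0 0 s) where
  comul i j := by
    rcases i with i | i <;> rcases j with j | j <;> simp [hr.comul, hs.comul]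
  counit i j := by
    rcases i with i | i <;> rcases j with j | j <;> simp [hr.counit, hs.counit, Matrix.one_apply]

theorem submatrix {ι' : Type*} [Fintype ι'] [DecidableEq ι'] (hr : IsCorep k r) (e : ι' ≃ ι) :
    IsCorep k (r.submatrix e e) where
  comul i j := by
    simp only [Matrix.submatrix_apply]
    rw [hr.comul, ← e.sum_comp]
  counit i j := by
    simp only [Matrix.submatrix_apply]
    rw [hr.counit]
    simp [Matrix.one_apply]

/-- A direct summand of a comodule, in coordinates. -/
theorem retract (hr : IsCorep k r) {C : Matrix ι κ k} {D : Matrix κ ι k} (hDC : D * C = 1)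
    (hC : Intertwines (C * D) r r) : IsCorep k (baseMat H D * r * baseMat H C) := by
  have he : baseMat H C * (baseMat H D * r) = r * (baseMat H C * baseMat H D) := by
    rw [← Matrix.mul_assoc, ← baseMat_mul]; exact hC
  refine of_map ?_ ?_
  · have he' := congrArg (fun x ↦ x.map (Algebra.TensorProduct.includeRight : H →ₐ[k] H ⊗[k] H)) he
    simp only [Matrix.map_mul, baseMat_map] at he' ⊢
    have hDC' : D.map (algebraMap k (H ⊗[k] H)) * C.map (algebraMap k (H ⊗[k] H)) = 1 := by
      rw [← Matrix.map_mul, hDC, Matrix.map_one _ (map_zero _) (map_one _)]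
    rw [hr.map_comul]
    set L := r.map (Algebra.TensorProduct.includeLeft : H →ₐ[k] H ⊗[k] H)
    set R := r.map (Algebra.TensorProduct.includeRight : H →ₐ[k] H ⊗[k] H)
    set C' := C.map (algebraMap k (H ⊗[k] H))
    set D' := D.map (algebraMap k (H ⊗[k] H))
    -- The idempotent `C * D` commutes with the coaction, so it can be moved from the right end to
    -- the place between the two tensor legs.
    calc D' * (L * R) * C' = D' * L * (R * (C' * D')) * C' := by
          simp only [Matrix.mul_assoc]; rw [hDC', Matrix.mul_one]
      _ = D' * L * C' * (D' * R * C') := by rw [← he']; simp only [Matrix.mul_assoc]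
  · have hc : r.map (Bialgebra.counitAlgHom k H) = 1 := hr.map_counit
    rw [Matrix.map_mul, Matrix.map_mul, baseMat_map, baseMat_map, hc, Matrix.mul_one]
    exact hDC

/-- The antipode of a commutative Hopf algebra is multiplicative. Applied to `r * S(r) = 1` it gives
`S(r) * S(S(r)) = 1`, and inverses are unique. -/
theorem dualMat_dualMat (hr : IsCorep k r) : dualMat k (dualMat k r) = r := by
  have h1 : r.map (HopfAlgebra.antipode k) * (r.map (HopfAlgebra.antipode k)).map
      (HopfAlgebra.antipode k) = 1 := by
    have h := congrArg (fun x : Matrix ι ι H ↦ x.map (HopfAlgebra.antipodeAlgHom k H))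
      hr.mul_antipode
    simp only [Matrix.map_mul] at h
    rw [Matrix.map_one _ (map_zero _) (map_one _)] at h
    exact h
  have h2 := left_inv_eq_right_inv hr.mul_antipode h1
  unfold dualMat
  rw [Matrix.transpose_map, Matrix.transpose_transpose]
  exact h2.symm

end IsCorep

/-- Multiply `F r = s F` by the inverses `S(s)` on the left and `S(r)` on the right, then transpose.
-/
theorem Intertwines.dual {ι κ : Type*} [Fintype ι] [Fintype κ] [DecidableEq ι] [DecidableEq κ]
    {r : Matrix ι ι H} {s : Matrix κ κ H} (hr : IsCorep k r) (hs : IsCorep k s)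
    {F : Matrix κ ι k} (hF : Intertwines F r s) : Intertwines Fᵀ (dualMat k s) (dualMat k r) := by
  unfold Intertwines dualMat at *
  rw [baseMat_transpose, ← Matrix.transpose_mul, ← Matrix.transpose_mul]
  congr 1
  calc s.map (HopfAlgebra.antipode k) * baseMat H F
      = s.map (HopfAlgebra.antipode k) * (baseMat H F * r) * r.map (HopfAlgebra.antipode k) := by
        rw [Matrix.mul_assoc, Matrix.mul_assoc, hr.mul_antipode, Matrix.mul_one]
    _ = baseMat H F * r.map (HopfAlgebra.antipode k) := by
        rw [hF, ← Matrix.mul_assoc, hs.antipode_mul, Matrix.one_mul]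

/-! ### Projective comodules: tensor products, duals, injectivity -/

/-- Projectivity with respect to surjections of finite-dimensional comodules, in coordinates. -/
def FProj (k : Type u) {H : Type u} [Field k] [CommRing H] [HopfAlgebra k H] {α : Type}
    [Fintype α] (p : Matrix α α H) : Prop :=
  ∀ ⦃ρ σ : Type⦄ [Fintype ρ] [DecidableEq ρ] [Fintype σ] [DecidableEq σ] (r : Matrix ρ ρ H)
    (s : Matrix σ σ H) (F : Matrix σ ρ k) (G : Matrix ρ σ k) (φ : Matrix σ α k),
    IsCorep k r → IsCorep k s → Intertwines F r s → F * G = 1 → Intertwines φ p s →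
      ∃ ψ : Matrix ρ α k, Intertwines ψ p r ∧ F * ψ = φ

section curry

variable {α β σ : Type} [Fintype α] [Fintype β] [Fintype σ] [DecidableEq α] [DecidableEq β]
  [DecidableEq σ]

/-- Currying of linear maps `P ⊗ V → S` to linear maps `P → S ⊗ V*`, in coordinates. -/
def curryMat (φ : Matrix σ (α × β) k) : Matrix (σ × β) α k :=
  Matrix.of fun x a ↦ φ x.1 (a, x.2)

/-- The inverse of `curryMat`. -/
def uncurryMat (φ : Matrix (σ × β) α k) : Matrix σ (α × β) k :=
  Matrix.of fun x a ↦ φ (x, a.2) a.1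

theorem curryMat_uncurryMat (φ : Matrix (σ × β) α k) : curryMat (uncurryMat φ) = φ := rfl

/-- The two conditions differ by right multiplication with `1 ⊗ v`, whose inverse is `1 ⊗ S(v)`. -/
theorem intertwines_curryMat_iff (p : Matrix α α H) {v : Matrix β β H} (hv : IsCorep k v)
    (s : Matrix σ σ H) (φ : Matrix σ (α × β) k) :
    Intertwines (curryMat φ) p (tensMat s (dualMat k v)) ↔ Intertwines φ (tensMat p v) s := by
  have h1 : ∀ x : σ × β, ∀ a, (baseMat H (curryMat φ) * p) x a =
      (baseMat H φ * tensMat p (1 : Matrix β β H)) x.1 (a, x.2) := by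
    intro x a
    simp [Matrix.mul_apply, Fintype.sum_prod_type, Matrix.one_apply, curryMat]
  have h2 : ∀ x : σ × β, ∀ a, (tensMat s (dualMat k v) * baseMat H (curryMat φ)) x a =
      (s * baseMat H φ * tensMat (1 : Matrix α α H) (v.map (HopfAlgebra.antipode k))) x.1
        (a, x.2) := by
    intro x a
    simp only [Matrix.mul_apply, Fintype.sum_prod_type, Matrix.one_apply, curryMat, dualMat,
      Matrix.kroneckerMap_apply, Matrix.transpose_apply, Matrix.map_apply, baseMat_apply,
      Matrix.of_apply, ite_mul, zero_mul, one_mul, mul_ite, mul_zero, Finset.sum_mul]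
    rw [Finset.sum_comm]
    rw [Finset.sum_comm (t := Finset.univ (α := β))]
    simp
    refine Finset.sum_congr rfl fun i _ ↦ Finset.sum_congr rfl fun j _ ↦ ?_
    ring
  have h3 : tensMat p v = tensMat p (1 : Matrix β β H) * tensMat (1 : Matrix α α H) v := by
    rw [tensMat, tensMat, tensMat, ← Matrix.mul_kronecker_mul, Matrix.mul_one, Matrix.one_mul]
  have h4 : tensMat (1 : Matrix α α H) v *
      tensMat (1 : Matrix α α H) (v.map (HopfAlgebra.antipode k)) = 1 := by
    rw [tensMat, tensMat, ← Matrix.mul_kronecker_mul, hv.mul_antipode, Matrix.mul_one]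
    exact Matrix.one_kronecker_one
  have h5 := mul_eq_one_comm.1 h4
  have h6 : Intertwines (curryMat φ) p (tensMat s (dualMat k v)) ↔
      baseMat H φ * tensMat p (1 : Matrix β β H) =
        s * baseMat H φ * tensMat (1 : Matrix α α H) (v.map (HopfAlgebra.antipode k)) := by
    constructor
    · intro h
      ext x ⟨a, b⟩
      rw [← h1 (x, b) a, ← h2 (x, b) a, h]
    · intro h
      ext x a
      rw [h1, h2, h]
  rw [h6, Intertwines, h3, ← Matrix.mul_assoc]
  constructor
  · intro h
    rw [h, Matrix.mul_assoc, h5, Matrix.mul_one]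
  · intro h
    rw [← h, Matrix.mul_assoc, h4, Matrix.mul_one]

end curry

namespace FProj

variable {α β γ : Type} [Fintype α] [Fintype β] [Fintype γ] [DecidableEq α] [DecidableEq β]
  [DecidableEq γ] {p : Matrix α α H} {q : Matrix β β H}

theorem of_retract (hq : FProj k q) {i : Matrix β α k} {j : Matrix α β k}
    (hi : Intertwines i p q) (hj : Intertwines j q p) (hji : j * i = 1) : FProj k p := by
  intro ρ σ _ _ _ _ r s F G φ hr hs hF hFG hφ
  obtain ⟨ψ, hψ, h⟩ := hq r s F G (φ * j) hr hs hF hFG (hφ.comp hj)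
  refine ⟨ψ * i, hψ.comp hi, ?_⟩
  rw [← Matrix.mul_assoc, h, Matrix.mul_assoc, hji, Matrix.mul_one]

/-- By currying, lifting a map from `P ⊗ Q` along `F` amounts to lifting a map from `P` along `F ⊗
Q*`, which is again split over `k`. -/
theorem tensor (hp : FProj k p) (hq : IsCorep k q) : FProj k (tensMat p q) := by
  intro ρ σ _ _ _ _ r s F G φ hr hs hF hFG hφ
  obtain ⟨ψ, hψ, h⟩ := hp (tensMat r (dualMat k q)) (tensMat s (dualMat k q))
    (kroneckerMap (· * ·) F (1 : Matrix β β k)) (kroneckerMap (· * ·) G (1 : Matrix β β k))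
    (curryMat φ) (hr.tensor hq.dual) (hs.tensor hq.dual) (hF.kronecker Intertwines.one)
    (by rw [← Matrix.mul_kronecker_mul, hFG, Matrix.mul_one]; exact Matrix.one_kronecker_one)
    ((intertwines_curryMat_iff p hq s φ).2 hφ)
  refine ⟨uncurryMat ψ, (intertwines_curryMat_iff p hq r _).1 (by rwa [curryMat_uncurryMat]), ?_⟩
  ext x ⟨a, b⟩
  have := congrFun (congrFun h (x, b)) a
  simpa [curryMat, uncurryMat, Matrix.mul_apply, Fintype.sum_prod_type, Matrix.one_apply] using this

theorem submatrix (hp : FProj k p) (e : β ≃ α) : FProj k (p.submatrix e e) := by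
  have h := (Intertwines.one (k := k) (r := p))
  refine hp.of_retract (i := (1 : Matrix α α k).submatrix (Equiv.refl α) e)
    (j := (1 : Matrix α α k).submatrix e (Equiv.refl α)) ?_ ?_ ?_
  · simpa using h.submatrix (Equiv.refl α) e
  · simpa using h.submatrix e (Equiv.refl α)
  · rw [Matrix.submatrix_mul_equiv]; simp

theorem tensor_left (hp : FProj k p) (hq : IsCorep k q) : FProj k (tensMat q p) := by
  have h := (hp.tensor hq).submatrix (Equiv.prodComm β α)
  convert h using 1
  ext ⟨i, i'⟩ ⟨j, j'⟩
  simp [mul_comm]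

/-- `P*` is a retract of `P ⊗ (P* ⊗ P*)`, which is projective because `P` is. The inclusion is
coevaluation on the first two factors. The retraction evaluates the first factor against the third;
it is equivariant because `H` is commutative. -/
theorem dual (hp : FProj k p) (hp' : IsCorep k p) : FProj k (dualMat k p) := by
  have h1 := hp.tensor (hp'.dual.tensor hp'.dual)
  have hA : ∀ a b, ∑ x, p a x * HopfAlgebra.antipode k (p x b) = (1 : Matrix α α H) a b := by
    intro a b
    rw [← hp'.mul_antipode, Matrix.mul_apply]
    rfl
  have hB : ∀ a b, ∑ x, p x b * HopfAlgebra.antipode k (p a x) = (1 : Matrix α α H) a b := by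
    intro a b
    rw [← hp'.antipode_mul, Matrix.mul_apply]
    exact Finset.sum_congr rfl fun _ _ ↦ mul_comm _ _
  refine h1.of_retract
    (i := Matrix.of fun x d ↦ if x.1 = x.2.1 then if x.2.2 = d then 1 else 0 else 0)
    (j := Matrix.of fun d x ↦ if x.1 = x.2.2 then if x.2.1 = d then 1 else 0 else 0) ?_ ?_ ?_
  · ext ⟨a, b, c⟩ d
    have : ∀ x, p a x * (HopfAlgebra.antipode k (p x b) * HopfAlgebra.antipode k (p d c)) =
        (p a x * HopfAlgebra.antipode k (p x b)) * HopfAlgebra.antipode k (p d c) :=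
      fun x ↦ (mul_assoc _ _ _).symm
    simp [Matrix.mul_apply, Fintype.sum_prod_type, dualMat, apply_ite (algebraMap k H), this,
      ← Finset.sum_mul, hA, Matrix.one_apply]
  · ext d ⟨a, b, c⟩
    have : ∀ x, p x a * (HopfAlgebra.antipode k (p b d) * HopfAlgebra.antipode k (p c x)) =
        (p x a * HopfAlgebra.antipode k (p c x)) * HopfAlgebra.antipode k (p b d) :=
      fun x ↦ by ring
    simp [Matrix.mul_apply, Fintype.sum_prod_type, dualMat, apply_ite (algebraMap k H), this,
      ← Finset.sum_mul, hB, Matrix.one_apply, eq_comm (a := a)]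
  · ext a b
    simp [Matrix.mul_apply, Fintype.sum_prod_type, Matrix.one_apply, eq_comm (a := a)]

/-- Projectives are injective: the transpose of `V` is a surjection onto the projective `P*`, so it
has an equivariant section, whose transpose is the retraction. -/
theorem exists_retraction {x : Matrix β β H} (hp : FProj k p) (hp' : IsCorep k p)
    (hx : IsCorep k x) {V : Matrix β α k} {L : Matrix α β k} (hV : Intertwines V p x)
    (hLV : L * V = 1) : ∃ π : Matrix α β k, Intertwines π x p ∧ π * V = 1 := by
  obtain ⟨ψ, hψ, h⟩ := hp.dual hp' (dualMat k x) (dualMat k p) Vᵀ Lᵀ 1 hx.dual hp'.dual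
    (hV.dual hp' hx) (by rw [← Matrix.transpose_mul, hLV, Matrix.transpose_one]) .one
  refine ⟨ψᵀ, ?_, ?_⟩
  · simpa only [hp'.dualMat_dualMat, hx.dualMat_dualMat] using hψ.dual hp'.dual hx.dual
  · have := congrArg Matrix.transpose h
    simpa [Matrix.transpose_mul] using this

theorem directSum (hp : FProj k p) (hq : FProj k q) : FProj k (Matrix.fromBlocks p 0 0 q) := by
  intro ρ σ _ _ _ _ r s F G φ hr hs hF hFG hφ
  have h0 : baseMat H φ = Matrix.fromCols (baseMat H φ.toCols₁) (baseMat H φ.toCols₂) := by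
    ext i (j | j) <;> rfl
  rw [Intertwines, h0, Matrix.fromCols_mul_fromBlocks, Matrix.mul_fromCols] at hφ
  simp only [Matrix.mul_zero, add_zero, zero_add] at hφ
  obtain ⟨h1, h2⟩ := Matrix.fromCols_inj hφ
  obtain ⟨ψ₁, hψ₁, e1⟩ := hp r s F G φ.toCols₁ hr hs hF hFG h1
  obtain ⟨ψ₂, hψ₂, e2⟩ := hq r s F G φ.toCols₂ hr hs hF hFG h2
  refine ⟨Matrix.fromCols ψ₁ ψ₂, ?_, ?_⟩
  · have h3 : baseMat H (Matrix.fromCols ψ₁ ψ₂) =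
        Matrix.fromCols (baseMat H ψ₁) (baseMat H ψ₂) := by
      ext i (j | j) <;> rfl
    rw [Intertwines, h3, Matrix.fromCols_mul_fromBlocks, Matrix.mul_fromCols]
    simp only [Matrix.mul_zero, add_zero, zero_add]
    rw [hψ₁, hψ₂]
  · rw [Matrix.mul_fromCols, e1, e2, Matrix.fromCols_toCols]

end FProj

/-! ### Maps through projectives and Fitting's lemma -/

/-- Homomorphisms that factor through a projective. -/
def ProjFactor {ι κ : Type} [Fintype ι] [Fintype κ] (r : Matrix ι ι H) (s : Matrix κ κ H)
    (h : Matrix κ ι k) : Prop :=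
  ∃ (α : Type) (_ : Fintype α) (_ : DecidableEq α) (p : Matrix α α H) (a : Matrix κ α k)
    (b : Matrix α ι k), IsCorep k p ∧ FProj k p ∧ Intertwines a p s ∧ Intertwines b r p ∧ h = a * b

namespace ProjFactor

variable {ι κ μ : Type} [Fintype ι] [Fintype κ] [Fintype μ] {r : Matrix ι ι H}
  {s : Matrix κ κ H} {t : Matrix μ μ H}

theorem add {h h' : Matrix κ ι k} (H₁ : ProjFactor r s h) (H₂ : ProjFactor r s h') :
    ProjFactor r s (h + h') := by
  obtain ⟨α, _, _, p, a, b, hp, hp', ha, hb, rfl⟩ := H₁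
  obtain ⟨β, _, _, q, c, d, hq, hq', hc, hd, rfl⟩ := H₂
  refine ⟨α ⊕ β, inferInstance, inferInstance, Matrix.fromBlocks p 0 0 q, Matrix.fromCols a c,
    Matrix.fromRows b d, hp.directSum hq, hp'.directSum hq', ?_, ?_, ?_⟩
  · have h3 : baseMat H (Matrix.fromCols a c) = Matrix.fromCols (baseMat H a) (baseMat H c) := by
      ext i (j | j) <;> rfl
    rw [Intertwines, h3, Matrix.fromCols_mul_fromBlocks, Matrix.mul_fromCols]
    simp only [Matrix.mul_zero, add_zero, zero_add]
    rw [ha, hc]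
  · have h3 : baseMat H (Matrix.fromRows b d) = Matrix.fromRows (baseMat H b) (baseMat H d) := by
      ext (j | j) i <;> rfl
    rw [Intertwines, h3, Matrix.fromBlocks_mul_fromRows, Matrix.fromRows_mul]
    simp only [Matrix.zero_mul, add_zero, zero_add]
    rw [hb, hd]
  · rw [Matrix.fromCols_mul_fromRows]

theorem comp_left {h : Matrix κ ι k} (H₁ : ProjFactor r s h) {g : Matrix μ κ k}
    (hg : Intertwines g s t) : ProjFactor r t (g * h) := by
  obtain ⟨α, _, _, p, a, b, hp, hp', ha, hb, rfl⟩ := H₁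
  exact ⟨α, _, _, p, g * a, b, hp, hp', hg.comp ha, hb, (Matrix.mul_assoc _ _ _).symm⟩

theorem comp_right {h : Matrix μ κ k} (H₁ : ProjFactor s t h) {g : Matrix κ ι k}
    (hg : Intertwines g r s) : ProjFactor r t (h * g) := by
  obtain ⟨α, _, _, p, a, b, hp, hp', ha, hb, rfl⟩ := H₁
  exact ⟨α, _, _, p, a, b * g, hp, hp', ha, hb.comp hg, Matrix.mul_assoc _ _ _⟩

end ProjFactor

/-- Idempotent matrices split. -/
theorem exists_split_of_idempotent {ι : Type*} [Fintype ι] [DecidableEq ι] {e : Matrix ι ι k}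
    (he : e * e = e) : ∃ (d : ℕ) (C : Matrix ι (Fin d) k) (D : Matrix (Fin d) ι k),
      D * C = 1 ∧ C * D = e := by
  let f := Matrix.toLin' e
  let b := Module.finBasis k (LinearMap.range f)
  refine ⟨_, LinearMap.toMatrix b (Pi.basisFun k ι) (LinearMap.range f).subtype,
    LinearMap.toMatrix (Pi.basisFun k ι) b f.rangeRestrict, ?_, ?_⟩
  · rw [← LinearMap.toMatrix_comp, ← LinearMap.toMatrix_id b]
    congr 1
    ext ⟨x, y, rfl⟩ i
    have : f (f y) = f y := by
      simp only [f]
      rw [← LinearMap.comp_apply, ← Matrix.toLin'_mul, he]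
    simp [this]
  · rw [← LinearMap.toMatrix_comp, LinearMap.subtype_comp_codRestrict]
    simp [f]

/-- A comodule without nonzero projective direct summands. -/
def ProjFree (k : Type u) {H : Type u} [Field k] [CommRing H] [HopfAlgebra k H] {ι : Type}
    [Fintype ι] (r : Matrix ι ι H) : Prop :=
  ∀ (d : ℕ) (R : Matrix (Fin d) (Fin d) H) (V : Matrix ι (Fin d) k) (W : Matrix (Fin d) ι k),
    IsCorep k R → FProj k R → Intertwines V R r → Intertwines W r R → W * V = 1 → d = 0

theorem intertwines_retract_left {ι κ : Type*} [Fintype ι] [Fintype κ] [DecidableEq κ]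
    {r : Matrix ι ι H} {C : Matrix ι κ k} {D : Matrix κ ι k} (hDC : D * C = 1)
    (hC : Intertwines (C * D) r r) : Intertwines C (baseMat H D * r * baseMat H C) r := by
  have hDC' : baseMat H D * baseMat H C = 1 := by rw [← baseMat_mul, hDC, baseMat_one]
  have he : baseMat H C * (baseMat H D * r) = r * (baseMat H C * baseMat H D) := by
    rw [← Matrix.mul_assoc, ← baseMat_mul]; exact hC
  rw [Intertwines, ← Matrix.mul_assoc, he, Matrix.mul_assoc, Matrix.mul_assoc, hDC',
    Matrix.mul_one]

theorem intertwines_retract_right {ι κ : Type*} [Fintype ι] [Fintype κ] [DecidableEq κ]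
    {r : Matrix ι ι H} {C : Matrix ι κ k} {D : Matrix κ ι k} (hDC : D * C = 1)
    (hC : Intertwines (C * D) r r) : Intertwines D r (baseMat H D * r * baseMat H C) := by
  have hDC' : baseMat H D * baseMat H C = 1 := by rw [← baseMat_mul, hDC, baseMat_one]
  have he : baseMat H C * (baseMat H D * r) = r * (baseMat H C * baseMat H D) := by
    rw [← Matrix.mul_assoc, ← baseMat_mul]; exact hC
  rw [Intertwines, Matrix.mul_assoc, Matrix.mul_assoc, ← he, ← Matrix.mul_assoc, hDC',
    Matrix.one_mul]

/-- Fitting's lemma: the part on which `φ` is nilpotent is a direct summand. There the identity is a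
multiple of `1 - φ`, so it factors through a projective; the summand is therefore projective, hence
zero. -/
theorem ProjFree.isUnit {ι : Type} [Fintype ι] [DecidableEq ι] {r : Matrix ι ι H}
    (hr : IsCorep k r) (hfree : ProjFree k r) {φ : Matrix ι ι k} (hφ : Intertwines φ r r)
    (hproj : ProjFactor r r (1 - φ)) : IsUnit φ := by
  obtain ⟨m, g, hg, hX⟩ : ∃ (m : ℕ) (g : Polynomial k), φ.charpoly = Polynomial.X ^ m * g ∧
      ¬ Polynomial.X ∣ g := by
    obtain ⟨g, hg, hX⟩ := Polynomial.exists_eq_pow_rootMultiplicity_mul_and_not_dvd φ.charpoly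
      φ.charpoly_monic.ne_zero 0
    rw [Polynomial.C_0, sub_zero] at hg hX
    exact ⟨_, g, hg, hX⟩
  -- The exponent is `m + 1` and not `m`, so that a factor `φ` can be split off at the end even when
  -- `m = 0`.
  have hcop : IsCoprime (Polynomial.X ^ (m + 1)) g :=
    ((Polynomial.irreducible_X.coprime_iff_not_dvd).2 hX).pow_left
  obtain ⟨u, v, huv⟩ := hcop
  obtain ⟨e, e_def⟩ : ∃ e, e = Polynomial.aeval φ (v * g) := ⟨_, rfl⟩
  have h1 : Polynomial.aeval φ u * φ ^ (m + 1) + e = 1 := by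
    simpa [e_def] using congrArg (Polynomial.aeval φ) huv
  have h2 : φ ^ (m + 1) * e = 0 := by
    have h3 : Polynomial.X ^ (m + 1) * (v * g) = Polynomial.X * v * φ.charpoly := by
      rw [hg]; ring
    have h4 := congrArg (Polynomial.aeval φ) h3
    rwa [map_mul, ← e_def, map_mul, Matrix.aeval_self_charpoly, mul_zero,
      Polynomial.aeval_X_pow] at h4
  have he : Intertwines e r r := e_def ▸ hφ.aeval _
  have hee : e * e = e := by
    have := congrArg (· * e) h1
    simpa [add_mul, mul_assoc, h2] using this
  -- Since `φ ^ (m + 1)` kills the image of `e`, the finite geometric series inverts `1 - φ` there.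
  have hgeom : e = (1 - φ) * ((∑ i ∈ Finset.range (m + 1), φ ^ i) * e) := by
    rw [← mul_assoc, mul_neg_geom_sum, sub_mul, h2, one_mul, sub_zero]
  have hs : Intertwines ((∑ i ∈ Finset.range (m + 1), φ ^ i) * e) r r := by
    have : ∑ i ∈ Finset.range (m + 1), φ ^ i = Polynomial.aeval φ
        (∑ i ∈ Finset.range (m + 1), (Polynomial.X : Polynomial k) ^ i) := by simp
    rw [this]
    exact (hφ.aeval _).comp he
  have hproj' := hproj.comp_right hs
  rw [← hgeom] at hproj'
  obtain ⟨α, _, _, p, a, b, hp, hp', ha, hb, hab⟩ := hproj'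
  obtain ⟨d, C, D, hDC, hCD⟩ := exists_split_of_idempotent hee
  have hC : Intertwines (C * D) r r := hCD ▸ he
  have hd : d = 0 := by
    refine hfree d (baseMat H D * r * baseMat H C) C D (hr.retract hDC hC) ?_
      (intertwines_retract_left hDC hC) (intertwines_retract_right hDC hC) hDC
    refine hp'.of_retract (hb.comp (intertwines_retract_left hDC hC))
      ((intertwines_retract_right hDC hC).comp ha) ?_
    calc D * a * (b * C) = D * (a * b) * C := by simp only [Matrix.mul_assoc]
      _ = (D * C) * (D * C) := by rw [← hab, ← hCD]; simp only [Matrix.mul_assoc]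
      _ = 1 := by rw [hDC, Matrix.mul_one]
  subst hd
  have he0 : e = 0 := by
    rw [← hCD]; ext; simp [Matrix.mul_apply]
  rw [he0, add_zero, pow_succ, ← mul_assoc] at h1
  exact IsUnit.of_mul_eq_one_right _ h1

/-! ### Free comodules and openness of containing a projective -/

section free

variable {α β γ : Type} [Fintype α] [Fintype β] [Fintype γ] [DecidableEq α] [DecidableEq β]
  [DecidableEq γ] (b : Module.Basis γ k H)

/-- The map `h ↦ ∑ h₁ bᶜ(h₂)`, for `bᶜ` in the dual basis of `b`. -/
noncomputable def rightCoeff (c : γ) : H →ₗ[k] H :=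
  (TensorProduct.rid k H).toLinearMap ∘ₗ (b.coord c).lTensor H ∘ₗ Coalgebra.comul

/-- The coefficient matrix of the dual of `H`, as a left module over itself. -/
noncomputable def regMat : Matrix γ γ H := Matrix.of fun d c ↦ rightCoeff b c (b d)

theorem comul_eq_sum_rightCoeff (h : H) :
    Coalgebra.comul (R := k) h = ∑ c, rightCoeff b c h ⊗ₜ[k] b c := by
  simp only [rightCoeff, LinearMap.comp_apply]
  generalize Coalgebra.comul (R := k) h = y
  induction y with
  | zero => simp
  | add x y hx hy =>
    simp only [map_add, TensorProduct.add_tmul, Finset.sum_add_distrib, ← hx, ← hy]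
  | tmul p q =>
    simp only [LinearMap.lTensor_tmul, LinearEquiv.coe_coe, TensorProduct.rid_tmul,
      TensorProduct.smul_tmul, ← TensorProduct.tmul_sum]
    simp [b.sum_repr]

theorem rightCoeff_eq_sum (c : γ) (h : H) :
    rightCoeff b c h = ∑ d, b.coord d h • regMat b d c := by
  conv_lhs => rw [← b.sum_repr h]
  simp [regMat, -Module.Basis.sum_repr]

/-- Both axioms come from those of `H`: apply a dual basis vector to the last tensor factor of
coassociativity and of the left counit law. -/
theorem isCorep_regMat : IsCorep k (regMat b) where
  comul d c := by
    let T : (H ⊗[k] H) ⊗[k] H →ₗ[k] H ⊗[k] H :=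
      (TensorProduct.rid k (H ⊗[k] H)).toLinearMap ∘ₗ (b.coord c).lTensor (H ⊗[k] H)
    have h1 : ∀ x : H ⊗[k] H, T ((Coalgebra.comul (R := k) (A := H)).rTensor H x) =
        Coalgebra.comul (R := k) (TensorProduct.rid k H ((b.coord c).lTensor H x)) := by
      intro x
      induction x with
      | zero => simp
      | add x y hx hy => simp only [map_add, hx, hy]
      | tmul p q => simp [T]
    have h2 : ∀ x : H ⊗[k] H, T ((TensorProduct.assoc k H H H).symm
        ((Coalgebra.comul (R := k) (A := H)).lTensor H x)) = (rightCoeff b c).lTensor H x := by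
      intro x
      induction x with
      | zero => simp
      | add x y hx hy => simp only [map_add, hx, hy]
      | tmul p q =>
        simp only [LinearMap.lTensor_tmul, rightCoeff, LinearMap.comp_apply, LinearEquiv.coe_coe]
        generalize Coalgebra.comul (R := k) q = y
        induction y with
        | zero => simp
        | add x y hx hy => simp only [map_add, TensorProduct.tmul_add, hx, hy]
        | tmul s t => simp [T]
    have h3 := h1 (Coalgebra.comul (R := k) (b d))
    rw [← Coalgebra.coassoc_symm_apply, h2, comul_eq_sum_rightCoeff b (b d), map_sum] at h3
    rw [← comul_eq_sum_rightCoeff b (b d)] at h3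
    simp only [LinearMap.lTensor_tmul] at h3
    exact h3.symm
  counit d c := by
    have h1 : ∀ x : H ⊗[k] H, Coalgebra.counit (R := k)
        (TensorProduct.rid k H ((b.coord c).lTensor H x)) =
        b.coord c (TensorProduct.lid k H ((Coalgebra.counit (R := k) (A := H)).rTensor H x)) := by
      intro x
      induction x with
      | zero => simp
      | add x y hx hy => simp only [map_add, hx, hy]
      | tmul p q => simp [mul_comm]
    have h2 := h1 (Coalgebra.comul (R := k) (b d))
    rw [Coalgebra.rTensor_counit_comul] at h2
    simpa [regMat, rightCoeff, Matrix.one_apply, Finsupp.single_apply] using h2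

/-- The homomorphism from a free comodule to the comodule with matrix `x` that sends the
generators to the columns of `V`. -/
noncomputable def freeHom (x : Matrix β β H) (V : Matrix β α k) : Matrix β (γ × α) k :=
  Matrix.of fun i ca ↦ ∑ j, b.coord ca.1 (x i j) * V j ca.2

/-- This is the map `f ⊗ e_a ↦ f · V_a` for the action of the dual algebra `H*` on a comodule. By
freeness `V` may be any linear map, so the same `V` can be used while `x` varies. -/
theorem intertwines_freeHom {x : Matrix β β H} (hx : IsCorep k x) (V : Matrix β α k) :
    Intertwines (freeHom b x V) (tensMat (regMat b) (1 : Matrix α α H)) x := by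
  have key : ∀ i j c, ∑ d, b.coord d (x i j) • regMat b d c = ∑ l, b.coord c (x l j) • x i l := by
    intro i j c
    rw [← rightCoeff_eq_sum, rightCoeff, LinearMap.comp_apply, LinearMap.comp_apply, hx.comul]
    simp
  ext i ⟨c, a⟩
  have h1 : (baseMat H (freeHom b x V) * tensMat (regMat b) (1 : Matrix α α H)) i (c, a) =
      ∑ j, algebraMap k H (V j a) * ∑ d, b.coord d (x i j) • regMat b d c := by
    simp only [Matrix.mul_apply, Fintype.sum_prod_type, Matrix.one_apply, freeHom,
      Matrix.kroneckerMap_apply, baseMat_apply, Matrix.of_apply, mul_ite, mul_one, mul_zero,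
      Finset.sum_ite_eq', Finset.mem_univ, if_true, map_sum, map_mul, Finset.sum_mul,
      Finset.mul_sum]
    rw [Finset.sum_comm]
    refine Finset.sum_congr rfl fun j _ ↦ Finset.sum_congr rfl fun d _ ↦ ?_
    rw [Algebra.smul_def]
    ring
  rw [h1]
  simp only [key, Matrix.mul_apply, freeHom, Finset.mul_sum, baseMat_apply, Matrix.of_apply,
    map_sum, map_mul]
  rw [Finset.sum_comm]
  refine Finset.sum_congr rfl fun j _ ↦ Finset.sum_congr rfl fun d _ ↦ ?_
  rw [Algebra.smul_def]
  ring

/-- Naturality: if `V` is already equivariant, acting on `V p` is the same as applying `V` after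
acting on `p`. -/
theorem freeHom_of_intertwines {x : Matrix β β H} {p : Matrix α α H} {V : Matrix β α k}
    (hV : Intertwines V p x) : freeHom b x V = V * freeHom b p (1 : Matrix α α k) := by
  ext i ⟨c, a⟩
  have h := congrArg (b.coord c) (congrFun (congrFun hV i) a)
  simp only [Matrix.mul_apply, baseMat_apply, map_sum, ← Algebra.smul_def, map_smul,
    mul_comm _ (algebraMap k H _)] at h
  simp only [freeHom, Matrix.mul_apply, Matrix.of_apply, Matrix.one_apply, mul_ite, mul_one,
    mul_zero, Finset.sum_ite_eq', Finset.mem_univ, if_true]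
  simp only [smul_eq_mul] at h
  rw [h]
  exact Finset.sum_congr rfl fun _ _ ↦ mul_comm _ _

/-- The action map `H* ⊗ P → P` has the linear section `v ↦ ε ⊗ v`, the counit being the unit of
`H*`. Projectivity of `P` makes an equivariant section out of it. -/
theorem FProj.exists_section {p : Matrix α α H} (hp : FProj k p) (hp' : IsCorep k p) :
    ∃ S : Matrix (γ × α) α k, Intertwines S p (tensMat (regMat b) (1 : Matrix α α H)) ∧
      freeHom b p (1 : Matrix α α k) * S = 1 := by
  refine hp _ p (freeHom b p (1 : Matrix α α k))
    (Matrix.of fun ca a ↦ Coalgebra.counit (R := k) (b ca.1) * (1 : Matrix α α k) ca.2 a) 1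
    ((isCorep_regMat b).tensor .one) hp' (intertwines_freeHom b hp' _) ?_ .one
  ext i j
  rw [← hp'.counit]
  conv_rhs => rw [← b.sum_repr (p i j)]
  simp [Matrix.mul_apply, Fintype.sum_prod_type, freeHom, Matrix.one_apply,
    -Module.Basis.sum_repr]

/-- Containing a given projective as a direct summand is an open condition. -/
theorem FProj.exists_polynomial {I : Type} (ℓ : β → β → γ → MvPolynomial I k)
    {p : Matrix α α H} (hp : FProj k p) (hp' : IsCorep k p) {x₀ : Matrix β β H}
    (z₀ : I → k) (hz₀ : ∀ i j c, b.coord c (x₀ i j) = MvPolynomial.eval z₀ (ℓ i j c))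
    {V : Matrix β α k} {L : Matrix α β k} (hV : Intertwines V p x₀) (hLV : L * V = 1) :
    ∃ φ : MvPolynomial I k, MvPolynomial.eval z₀ φ = 1 ∧
      ∀ (x : Matrix β β H) (z : I → k), IsCorep k x →
        (∀ i j c, b.coord c (x i j) = MvPolynomial.eval z (ℓ i j c)) →
        MvPolynomial.eval z φ ≠ 0 →
        ∃ (W : Matrix β α k) (π : Matrix α β k), Intertwines W p x ∧ Intertwines π x p ∧
          π * W = 1 := by
  obtain ⟨S, hS, hS'⟩ := hp.exists_section b hp'
  let F : Matrix β (γ × α) (MvPolynomial I k) :=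
    Matrix.of fun i ca ↦ ∑ j, ℓ i j ca.1 * MvPolynomial.C (V j ca.2)
  -- The composite `P → H* ⊗ P → X`, with first map `S` and second map `freeHom b x V`, is
  -- equivariant for every `x` and polynomial in the parameters. At `x₀` it is `V`, so the
  -- determinant of its composite with `L` is `1` there; where the determinant is nonzero, the
  -- composite is injective.
  let φ := (L.map (MvPolynomial.C (σ := I)) * F * S.map (MvPolynomial.C (σ := I))).det
  have hφ : ∀ (x : Matrix β β H) (z : I → k),
      (∀ i j c, b.coord c (x i j) = MvPolynomial.eval z (ℓ i j c)) →
      MvPolynomial.eval z φ = (L * (freeHom b x V * S)).det := by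
    intro x z hz
    have hC : ∀ {μ ν : Type} (A : Matrix μ ν k),
        (A.map (MvPolynomial.C (σ := I))).map (MvPolynomial.eval z) = A := by
      intro μ ν A; ext; simp
    have hF : F.map (MvPolynomial.eval z) = freeHom b x V := by
      ext i ⟨c, a⟩
      simp [F, freeHom, ← hz, -Module.Basis.coord_apply]
    rw [RingHom.map_det, RingHom.mapMatrix_apply, Matrix.map_mul, Matrix.map_mul, hC, hC, hF,
      Matrix.mul_assoc]
  refine ⟨φ, ?_, ?_⟩
  · rw [hφ x₀ z₀ hz₀, freeHom_of_intertwines b hV, Matrix.mul_assoc, hS', Matrix.mul_one, hLV,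
      Matrix.det_one]
  · intro x z hx hz hne
    rw [hφ x z hz] at hne
    have hW := (intertwines_freeHom b hx V).comp hS
    have hinv := Matrix.nonsing_inv_mul _ (isUnit_iff_ne_zero.2 hne)
    rw [← Matrix.mul_assoc] at hinv
    obtain ⟨π, hπ, h⟩ := hp.exists_retraction hp' hx hW hinv
    exact ⟨_, π, hW, hπ, h⟩

end free

/-! ### Finite covers, endotriviality in coordinates, complements -/

/-- Quasi-compactness in affine space. -/
theorem exists_finite_subcover {I J : Type*} [Finite I] (φ : J → MvPolynomial I k) :
    ∃ T : Finset J, ∀ (z : I → k) (j : J), MvPolynomial.eval z (φ j) ≠ 0 →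
      ∃ i ∈ T, MvPolynomial.eval z (φ i) ≠ 0 := by
  classical
  obtain ⟨T, hT⟩ : ∃ T : Finset J, Ideal.span (Set.range φ) ≤ Ideal.span (φ '' T) := by
    have h := IsNoetherian.noetherian (Ideal.span (Set.range φ))
    obtain ⟨t, ht, he⟩ := Submodule.fg_span_iff_fg_span_finset_subset _ |>.1 h
    obtain ⟨T, rfl⟩ : ∃ T : Finset J, T.image φ = t := by
      rw [← Set.image_univ] at ht
      obtain ⟨T, -, hT⟩ := Finset.subset_set_image_iff.1 ht
      exact ⟨T, hT⟩
    refine ⟨T, le_of_eq ?_⟩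
    rw [Finset.coe_image] at he
    exact he
  refine ⟨T, fun z j hj ↦ ?_⟩
  by_contra! hcon
  have h1 : Ideal.span (φ '' T) ≤ RingHom.ker (MvPolynomial.eval z) := by
    rw [Ideal.span_le]
    rintro _ ⟨i, hi, rfl⟩
    exact hcon i hi
  exact hj (h1 (hT (Ideal.subset_span ⟨j, rfl⟩)))

/-- Isomorphism of comodules, in coordinates. -/
def MatIso (k : Type u) {H : Type u} [Field k] [CommRing H] [HopfAlgebra k H] {ι κ : Type}
    [Fintype ι] [Fintype κ] [DecidableEq ι] [DecidableEq κ] (r : Matrix ι ι H)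
    (s : Matrix κ κ H) : Prop :=
  ∃ (A : Matrix κ ι k) (B : Matrix ι κ k), Intertwines A r s ∧ Intertwines B s r ∧
    B * A = 1 ∧ A * B = 1

/-- Endotriviality, in coordinates. -/
def MatEndotrivial (k : Type u) {H : Type u} [Field k] [CommRing H] [HopfAlgebra k H] {ι : Type}
    [Fintype ι] [DecidableEq ι] (r : Matrix ι ι H) : Prop :=
  ∃ (d : ℕ) (q : Matrix (Fin d) (Fin d) H) (i : Matrix (ι × ι) Unit k)
    (j : Matrix Unit (ι × ι) k) (V : Matrix (ι × ι) (Fin d) k) (W : Matrix (Fin d) (ι × ι) k),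
    IsCorep k q ∧ FProj k q ∧ Intertwines i 1 (tensMat r (dualMat k r)) ∧
    Intertwines j (tensMat r (dualMat k r)) 1 ∧ Intertwines V q (tensMat r (dualMat k r)) ∧
    Intertwines W (tensMat r (dualMat k r)) q ∧ j * i = 1 ∧ W * V = 1 ∧ i * j + V * W = 1 ∧
    Fintype.card (ι × ι) = 1 + d

/-- The comodule with coefficient matrix `s` has a projective direct summand of dimension `d`. -/
def HasProjSummand (k : Type u) {H : Type u} [Field k] [CommRing H] [HopfAlgebra k H] {ι : Type}
    [Fintype ι] (s : Matrix ι ι H) (d : ℕ) : Prop :=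
  ∃ (R : Matrix (Fin d) (Fin d) H) (V : Matrix ι (Fin d) k) (W : Matrix (Fin d) ι k),
    IsCorep k R ∧ FProj k R ∧ Intertwines V R s ∧ Intertwines W s R ∧ W * V = 1

theorem Intertwines.inv {ι κ : Type*} [Fintype ι] [Fintype κ] [DecidableEq ι] [DecidableEq κ]
    {r : Matrix ι ι H} {s : Matrix κ κ H} {A : Matrix κ ι k} {B : Matrix ι κ k}
    (hA : Intertwines A r s) (hBA : B * A = 1) (hAB : A * B = 1) : Intertwines B s r := by
  have h1 : baseMat H B * baseMat H A = 1 := by rw [← baseMat_mul, hBA, baseMat_one]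
  have h2 : baseMat H A * baseMat H B = 1 := by rw [← baseMat_mul, hAB, baseMat_one]
  calc baseMat H B * s = baseMat H B * (s * baseMat H A) * baseMat H B := by
        rw [Matrix.mul_assoc, Matrix.mul_assoc, h2, Matrix.mul_one]
    _ = r * baseMat H B := by
        rw [← hA, ← Matrix.mul_assoc, h1, Matrix.one_mul]

section linear

variable {β α : Type*} [Fintype α] [Fintype β] [DecidableEq α] [DecidableEq β]

/-- Split the idempotent `1 - V * W`. The block matrices formed from `C, V` and from `D, W` are
mutually inverse, hence square, which is the dimension count. -/
theorem exists_complement {V : Matrix β α k} {W : Matrix α β k} (hWV : W * V = 1) :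
    ∃ (d : ℕ) (C : Matrix β (Fin d) k) (D : Matrix (Fin d) β k), D * C = 1 ∧
      C * D + V * W = 1 ∧ W * C = 0 ∧ D * V = 0 ∧ Fintype.card β = d + Fintype.card α := by
  have he : (1 - V * W) * (1 - V * W) = 1 - V * W := by
    have : V * W * (V * W) = V * W := by
      rw [Matrix.mul_assoc, ← Matrix.mul_assoc W, hWV, Matrix.one_mul]
    rw [sub_mul, one_mul, mul_sub, mul_one, this, sub_self, sub_zero]
  obtain ⟨d, C, D, hDC, hCD⟩ := exists_split_of_idempotent he
  have h1 : C * D + V * W = 1 := by rw [hCD]; abel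
  have hWC : W * C = 0 := by
    calc W * C = W * (C * D) * C := by
          rw [Matrix.mul_assoc, Matrix.mul_assoc, hDC, Matrix.mul_one]
      _ = 0 := by
          rw [hCD, Matrix.mul_sub, ← Matrix.mul_assoc, hWV]; simp
  have hDV : D * V = 0 := by
    calc D * V = D * (C * D) * V := by
          rw [← Matrix.mul_assoc, hDC, Matrix.one_mul]
      _ = 0 := by
          rw [hCD, Matrix.mul_assoc, Matrix.sub_mul, Matrix.mul_assoc, hWV]; simp
  refine ⟨d, C, D, hDC, h1, hWC, hDV, ?_⟩
  have := Matrix.square_of_invertible (Matrix.fromCols C V) (Matrix.fromRows D W)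
    (by rw [Matrix.fromCols_mul_fromRows, h1])
    (by rw [Matrix.fromRows_mul_fromCols, hDC, hWV, hWC, hDV, Matrix.fromBlocks_one])
  simpa using this

end linear

theorem intertwines_complement {ι κ α : Type*} [Fintype ι] [Fintype κ] [Fintype α]
    [DecidableEq κ] [DecidableEq ι] {x : Matrix ι ι H} {q : Matrix α α H}
    {C : Matrix ι κ k} {D : Matrix κ ι k} {V : Matrix ι α k} {W : Matrix α ι k}
    (hV : Intertwines V q x) (hW : Intertwines W x q) (h : C * D + V * W = 1) :
    Intertwines (C * D) x x := by
  rw [eq_sub_of_add_eq h]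
  exact Intertwines.one.sub (hV.comp hW)

/-- If a comodule has a projective summand of codimension one, the complement is given by a
group-like element. -/
theorem exists_groupLike {β α : Type} [Fintype α] [Fintype β] [DecidableEq α] [DecidableEq β]
    {x : Matrix β β H} {q : Matrix α α H} (hx : IsCorep k x) {V : Matrix β α k}
    {W : Matrix α β k} (hV : Intertwines V q x) (hW : Intertwines W x q) (hWV : W * V = 1)
    (hcard : Fintype.card β = 1 + Fintype.card α) :
    ∃ w : H, IsGroupLikeElem k w ∧ ∃ (C : Matrix β (Fin 1) k) (D : Matrix (Fin 1) β k),
      Intertwines C (Matrix.of fun _ _ ↦ w) x ∧ Intertwines D x (Matrix.of fun _ _ ↦ w) ∧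
      D * C = 1 ∧ C * D + V * W = 1 ∧ W * C = 0 ∧ D * V = 0 := by
  obtain ⟨d, C, D, hDC, h1, h2, h3, h4⟩ := exists_complement hWV
  obtain rfl : d = 1 := by omega
  have he := intertwines_complement hV hW h1
  have ht := hx.retract hDC he
  have hw : (Matrix.of fun _ _ ↦ (baseMat H D * x * baseMat H C) 0 0 :
      Matrix (Fin 1) (Fin 1) H) = baseMat H D * x * baseMat H C := by
    ext i j
    rw [Subsingleton.elim i 0, Subsingleton.elim j 0]
    rfl
  -- For a one-by-one matrix the two corepresentation axioms are those of a group-like element.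
  refine ⟨(baseMat H D * x * baseMat H C) 0 0, ⟨?_, ?_⟩, C, D, ?_, ?_, hDC, h1, h2, h3⟩
  · rw [ht.counit]; simp
  · rw [ht.comul]; simp
  · rw [hw]; exact intertwines_retract_left hDC he
  · rw [hw]; exact intertwines_retract_right hDC he

/-! ### Stable isomorphism and cancellation -/

section stable

variable {ι σ τ : Type} [Fintype ι] [Fintype σ] [Fintype τ] [DecidableEq ι] [DecidableEq σ]
  [DecidableEq τ]

/-- The reindexing that is used to identify `(S ⊗ M*) ⊗ M` with `S ⊗ (M ⊗ M*)`. -/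
def assocSwap (σ ι : Type) : (σ × ι) × ι ≃ σ × (ι × ι) :=
  (Equiv.prodAssoc σ ι ι).trans ((Equiv.refl σ).prodCongr (Equiv.prodComm ι ι))

theorem tensMat_submatrix_assocSwap (s : Matrix σ σ H) (r r' : Matrix ι ι H) :
    (tensMat s (tensMat r r')).submatrix (assocSwap σ ι) (assocSwap σ ι) =
      tensMat (tensMat s r') r := by
  ext ⟨⟨a, b⟩, c⟩ ⟨⟨a', b'⟩, c'⟩
  simp [assocSwap]
  ring

theorem tensMat_submatrix_unit (s : Matrix σ σ H) :
    (tensMat s (1 : Matrix Unit Unit H)).submatrix (Equiv.prodPUnit σ).symm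
      (Equiv.prodPUnit σ).symm = s := by
  ext a b
  simp

/-- If `M` is endotrivial and `S ⊗ M*` is isomorphic to `T ⊗ M*`, then `S` and `T` are stably
isomorphic. -/
theorem MatEndotrivial.exists_stable {r : Matrix ι ι H} (hend : MatEndotrivial k r)
    {s : Matrix σ σ H} {t : Matrix τ τ H} (ht : IsCorep k t)
    {A : Matrix (τ × ι) (σ × ι) k} {B : Matrix (σ × ι) (τ × ι) k}
    (hA : Intertwines A (tensMat s (dualMat k r)) (tensMat t (dualMat k r)))
    (hB : Intertwines B (tensMat t (dualMat k r)) (tensMat s (dualMat k r))) (hBA : B * A = 1) :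
    ∃ (f : Matrix τ σ k) (g : Matrix σ τ k), Intertwines f s t ∧ Intertwines g t s ∧
      ProjFactor s s (1 - g * f) := by
  obtain ⟨d, q, i, j, V, W, hq, hq', hi, hj, hV, hW, hji, -, hsum, -⟩ := hend
  -- Tensoring `k → M ⊗ M* → k` with a module and reordering factors makes that module a summand of
  -- `(S ⊗ M*) ⊗ M`; `hV'` and `hW'` below describe the projective complement for `t`.
  have hi' : ∀ {σ : Type} [Fintype σ] [DecidableEq σ] (s : Matrix σ σ H),
      Intertwines ((kroneckerMap (· * ·) (1 : Matrix σ σ k) i).submatrix (assocSwap σ ι)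
        (Equiv.prodPUnit σ).symm) s (tensMat (tensMat s (dualMat k r)) r) := by
    intro σ _ _ s
    have h := ((Intertwines.one (k := k) (r := s)).kronecker hi).submatrix (assocSwap σ ι)
      (Equiv.prodPUnit σ).symm
    rwa [tensMat_submatrix_assocSwap, tensMat_submatrix_unit] at h
  have hj' : ∀ {σ : Type} [Fintype σ] [DecidableEq σ] (s : Matrix σ σ H),
      Intertwines ((kroneckerMap (· * ·) (1 : Matrix σ σ k) j).submatrix (Equiv.prodPUnit σ).symm
        (assocSwap σ ι)) (tensMat (tensMat s (dualMat k r)) r) s := by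
    intro σ _ _ s
    have h := ((Intertwines.one (k := k) (r := s)).kronecker hj).submatrix
      (Equiv.prodPUnit σ).symm (assocSwap σ ι)
    rwa [tensMat_submatrix_assocSwap, tensMat_submatrix_unit] at h
  have hV' := ((Intertwines.one (k := k) (r := t)).kronecker hV).submatrix (assocSwap τ ι)
      (Equiv.refl _)
  have hW' := ((Intertwines.one (k := k) (r := t)).kronecker hW).submatrix
      (Equiv.refl _) (assocSwap τ ι)
  rw [tensMat_submatrix_assocSwap] at hV' hW'
  have hA' := hA.kronecker (Intertwines.one (k := k) (r := r))
  have hB' := hB.kronecker (Intertwines.one (k := k) (r := r))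
  have hBA' : kroneckerMap (· * ·) B (1 : Matrix ι ι k) * kroneckerMap (· * ·) A
      (1 : Matrix ι ι k) = 1 := by
    rw [← Matrix.mul_kronecker_mul, hBA, Matrix.mul_one]
    exact Matrix.one_kronecker_one
  have hji' : (kroneckerMap (· * ·) (1 : Matrix σ σ k) j).submatrix (Equiv.prodPUnit σ).symm
        (assocSwap σ ι) * (kroneckerMap (· * ·) (1 : Matrix σ σ k) i).submatrix (assocSwap σ ι)
        (Equiv.prodPUnit σ).symm = 1 := by
    rw [Matrix.submatrix_mul_equiv, ← Matrix.mul_kronecker_mul, hji, Matrix.mul_one]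
    erw [Matrix.one_kronecker_one]
    simp
  have hsum' : (kroneckerMap (· * ·) (1 : Matrix τ τ k) i).submatrix (assocSwap τ ι)
        (Equiv.prodPUnit τ).symm * (kroneckerMap (· * ·) (1 : Matrix τ τ k) j).submatrix
        (Equiv.prodPUnit τ).symm (assocSwap τ ι) +
      (kroneckerMap (· * ·) (1 : Matrix τ τ k) V).submatrix (assocSwap τ ι) (Equiv.refl _) *
      (kroneckerMap (· * ·) (1 : Matrix τ τ k) W).submatrix (Equiv.refl _) (assocSwap τ ι) = 1 := by
    rw [Matrix.submatrix_mul_equiv, Matrix.submatrix_mul_equiv, ← Matrix.mul_kronecker_mul,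
      ← Matrix.mul_kronecker_mul, Matrix.mul_one]
    have h : kroneckerMap (· * ·) (1 : Matrix τ τ k) (i * j) +
        kroneckerMap (· * ·) (1 : Matrix τ τ k) (V * W) = 1 := by
      have := Matrix.kronecker_add (1 : Matrix τ τ k) (i * j) (V * W)
      rw [hsum, Matrix.one_kronecker_one] at this
      exact this.symm
    rw [← Matrix.submatrix_one_equiv (assocSwap τ ι), ← h]
    rfl
  have hi₁ := hi' s
  have hi₂ := hi' t
  have hj₁ := hj' s
  have hj₂ := hj' t
  clear hi' hj'
  generalize (kroneckerMap (· * ·) (1 : Matrix τ τ k) V).submatrix (assocSwap τ ι)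
    (Equiv.refl _) = V' at *
  generalize (kroneckerMap (· * ·) (1 : Matrix τ τ k) W).submatrix (Equiv.refl _)
    (assocSwap τ ι) = W' at *
  generalize (kroneckerMap (· * ·) (1 : Matrix σ σ k) i).submatrix (assocSwap σ ι)
    (Equiv.prodPUnit σ).symm = i₁ at *
  generalize (kroneckerMap (· * ·) (1 : Matrix τ τ k) i).submatrix (assocSwap τ ι)
    (Equiv.prodPUnit τ).symm = i₂ at *
  generalize (kroneckerMap (· * ·) (1 : Matrix σ σ k) j).submatrix (Equiv.prodPUnit σ).symm
    (assocSwap σ ι) = j₁ at *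
  generalize (kroneckerMap (· * ·) (1 : Matrix τ τ k) j).submatrix (Equiv.prodPUnit τ).symm
    (assocSwap τ ι) = j₂ at *
  generalize kroneckerMap (· * ·) A (1 : Matrix ι ι k) = A' at *
  generalize kroneckerMap (· * ·) B (1 : Matrix ι ι k) = B' at *
  refine ⟨j₂ * A' * i₁, j₁ * B' * i₂, (hj₂.comp hA').comp hi₁, (hj₁.comp hB').comp hi₂, ?_⟩
  -- Since `B' A' = 1`, the defect `1 - g f` equals `j₁ B' (1 - i₂ j₂) A' i₁`, and `1 - i₂ j₂ = V'
  -- W'` factors through the projective `T ⊗ Q`.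
  refine ⟨τ × Fin d, inferInstance, inferInstance, tensMat t q, j₁ * B' * V', W' * A' * i₁,
    ht.tensor hq, hq'.tensor_left ht, (hj₁.comp hB').comp hV', (hW'.comp hA').comp hi₁, ?_⟩
  have h1 : j₁ * B' * i₂ * (j₂ * A' * i₁) = j₁ * B' * (i₂ * j₂) * (A' * i₁) := by
    simp only [Matrix.mul_assoc]
  have h2 : j₁ * B' * V' * (W' * A' * i₁) = j₁ * B' * (V' * W') * (A' * i₁) := by
    simp only [Matrix.mul_assoc]
  rw [h1, h2, sub_eq_iff_eq_add, ← Matrix.add_mul, ← Matrix.mul_add, add_comm, hsum',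
    Matrix.mul_one, Matrix.mul_assoc, ← Matrix.mul_assoc B', hBA', Matrix.one_mul, hji']

end stable

theorem HasProjSummand.of_fintype {ι α : Type} [Fintype ι] [Fintype α] [DecidableEq α]
    [DecidableEq ι] {s : Matrix ι ι H} {R : Matrix α α H} {V : Matrix ι α k} {W : Matrix α ι k}
    (hR : IsCorep k R) (hR' : FProj k R) (hV : Intertwines V R s) (hW : Intertwines W s R)
    (hWV : W * V = 1) : HasProjSummand k s (Fintype.card α) := by
  let e := (Fintype.equivFin α).symm
  refine ⟨R.submatrix e e, V.submatrix (Equiv.refl ι) e, W.submatrix e (Equiv.refl ι),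
    hR.submatrix e, hR'.submatrix e, ?_, ?_, ?_⟩
  · simpa using hV.submatrix (Equiv.refl ι) e
  · simpa using hW.submatrix e (Equiv.refl ι)
  · rw [Matrix.submatrix_mul_equiv, hWV]; simp

/-- Cancellation of a projective summand of maximal dimension. -/
theorem matIso_of_stable {σ α : Type} [Fintype σ] [DecidableEq σ] [Fintype α] [DecidableEq α]
    {s t : Matrix σ σ H} (hs : IsCorep k s)
    {f g : Matrix σ σ k} (hf : Intertwines f s t) (hg : Intertwines g t s)
    (hgf : ProjFactor s s (1 - g * f)) {R : Matrix α α H} (hR : IsCorep k R) (hR' : FProj k R)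
    {V V' : Matrix σ α k} {W W' : Matrix α σ k} (hV : Intertwines V R s)
    (hW : Intertwines W s R) (hWV : W * V = 1) (hV' : Intertwines V' R t)
    (hW' : Intertwines W' t R) (hWV' : W' * V' = 1)
    (hmax : ∀ d, HasProjSummand k s d → d ≤ Fintype.card α) : MatIso k s t := by
  obtain ⟨d, C, D, hDC, h1, hWC, hDV, hd⟩ := exists_complement hWV
  obtain ⟨d', C', D', hDC', h1', hWC', hDV', hd'⟩ := exists_complement hWV'
  -- Both complements have the same dimension, so the induced maps between them are square and
  -- one-sided inverses are two-sided.
  obtain rfl : d = d' := by omega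
  have he := intertwines_complement hV hW h1
  have he' := intertwines_complement hV' hW' h1'
  have hC := intertwines_retract_left hDC he
  have hD := intertwines_retract_right hDC he
  have hC' := intertwines_retract_left hDC' he'
  have hD' := intertwines_retract_right hDC' he'
  have hs₀ := hs.retract hDC he
  -- A projective summand of the complement could be added to `R`, against the maximality of the
  -- dimension of `R`.
  have hfree : ProjFree k (baseMat H D * s * baseMat H C) := by
    intro m Q X Y hQ hQ' hX hY hYX
    have hX' := hC.comp hX
    have hY' := hY.comp hD
    have h := hmax _ (HasProjSummand.of_fintype (α := α ⊕ Fin m)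
      (R := Matrix.fromBlocks R 0 0 Q) (V := Matrix.fromCols V (C * X))
      (W := Matrix.fromRows W (Y * D)) (s := s) (hR.directSum hQ) (hR'.directSum hQ') ?_ ?_ ?_)
    · simpa using h
    · have h3 : baseMat H (Matrix.fromCols V (C * X)) =
          Matrix.fromCols (baseMat H V) (baseMat H (C * X)) := by
        ext i (j | j) <;> rfl
      rw [Intertwines, h3, Matrix.fromCols_mul_fromBlocks, Matrix.mul_fromCols]
      simp only [Matrix.mul_zero, add_zero, zero_add]
      rw [hV, hX']
    · have h3 : baseMat H (Matrix.fromRows W (Y * D)) =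
          Matrix.fromRows (baseMat H W) (baseMat H (Y * D)) := by
        ext (j | j) i <;> rfl
      rw [Intertwines, h3, Matrix.fromBlocks_mul_fromRows, Matrix.fromRows_mul]
      simp only [Matrix.zero_mul, add_zero, zero_add]
      rw [hW, hY']
    · rw [Matrix.fromRows_mul_fromCols, hWV, ← Matrix.mul_assoc, hWC, Matrix.mul_assoc Y, hDV,
        Matrix.mul_assoc Y, ← Matrix.mul_assoc D, hDC, Matrix.one_mul, hYX, Matrix.zero_mul,
        Matrix.mul_zero, Matrix.fromBlocks_one]
  have hf₀ := (hD'.comp hf).comp hC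
  have hg₀ := (hD.comp hg).comp hC'
  -- Restricting to complements changes `1 - g f` only by the part of `g f` that passes through the
  -- copy of `R` in `t`, and that factors through a projective.
  have hproj : ProjFactor (baseMat H D * s * baseMat H C) (baseMat H D * s * baseMat H C)
      (1 - (D * g * C') * (D' * f * C)) := by
    have h2 : ProjFactor (baseMat H D * s * baseMat H C) (baseMat H D * s * baseMat H C)
        ((D * g * V') * (W' * f * C)) :=
      ⟨α, inferInstance, inferInstance, R, _, _, hR, hR', (hD.comp hg).comp hV',
        (hW'.comp hf).comp hC, rfl⟩
    have h3 := ((hgf.comp_left hD).comp_right hC).add h2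
    convert h3 using 1
    have e1 : D * g * C' * (D' * f * C) = D * g * (C' * D') * (f * C) := by
      simp only [Matrix.mul_assoc]
    have e2 : D * g * V' * (W' * f * C) = D * g * (V' * W') * (f * C) := by
      simp only [Matrix.mul_assoc]
    have e3 : D * (1 - g * f) * C = 1 - D * g * (f * C) := by
      rw [Matrix.mul_sub, Matrix.sub_mul, Matrix.mul_one, hDC]
      simp only [Matrix.mul_assoc]
    rw [e1, e2, e3, eq_sub_of_add_eq h1', Matrix.mul_sub, Matrix.sub_mul, Matrix.mul_one]
    abel
  obtain ⟨B, hB⟩ := (hfree.isUnit hs₀ (hg₀.comp hf₀) hproj).exists_left_inv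
  rw [← Matrix.mul_assoc] at hB
  have hB' := mul_eq_one_comm.1 hB
  have hB₀ := hf₀.inv hB hB'
  generalize D' * f * C = f₀ at *
  generalize B * (D * g * C') = g₀ at *
  -- Glue the isomorphism of complements to the identity of the common summand `R`.
  have hA : Intertwines (C' * f₀ * D + V' * W) s t :=
    ((hC'.comp hf₀).comp hD).add (hV'.comp hW)
  have hBB : Intertwines (C * g₀ * D' + V * W') t s :=
    ((hC.comp hB₀).comp hD').add (hV.comp hW')
  have hmul : (C * g₀ * D' + V * W') * (C' * f₀ * D + V' * W) = 1 := by
    have e1 : C * g₀ * D' * (C' * f₀ * D) = C * D := by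
      calc C * g₀ * D' * (C' * f₀ * D) = C * (g₀ * ((D' * C') * f₀)) * D := by
            simp only [Matrix.mul_assoc]
        _ = C * D := by rw [hDC', Matrix.one_mul, hB, Matrix.mul_one]
    have e2 : C * g₀ * D' * (V' * W) = 0 := by
      rw [Matrix.mul_assoc, ← Matrix.mul_assoc D', hDV']; simp
    have e3 : V * W' * (C' * f₀ * D) = 0 := by
      rw [Matrix.mul_assoc, ← Matrix.mul_assoc W', ← Matrix.mul_assoc W', hWC']; simp
    have e4 : V * W' * (V' * W) = V * W := by
      rw [Matrix.mul_assoc, ← Matrix.mul_assoc W', hWV', Matrix.one_mul]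
    rw [Matrix.add_mul, Matrix.mul_add, Matrix.mul_add, e1, e2, e3, e4, zero_add, add_zero, h1]
  exact ⟨_, _, hA, hBB, hmul, mul_eq_one_comm.1 hmul⟩

/-! ### The finiteness argument in coordinates -/

/-- Distinct group-like elements are linearly independent. -/
theorem finite_isGroupLikeElem [Module.Finite k H] : {w : H | IsGroupLikeElem k w}.Finite :=
  (linearIndepOn_isGroupLikeElem (R := k) (A := H)).setFinite

theorem HasProjSummand.zero {ι : Type} [Fintype ι] (s : Matrix ι ι H) : HasProjSummand k s 0 := by
  refine ⟨0, 0, 0, ⟨fun i ↦ i.elim0, fun i ↦ i.elim0⟩, ?_, .zero, .zero, ?_⟩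
  · intro ρ σ _ _ _ _ r s F G φ _ _ _ _ _
    exact ⟨0, .zero, by ext i j; exact j.elim0⟩
  · ext i; exact i.elim0

theorem HasProjSummand.le {ι : Type} [Fintype ι] [DecidableEq ι] {s : Matrix ι ι H} {d : ℕ}
    (h : HasProjSummand k s d) : d ≤ Fintype.card ι := by
  obtain ⟨R, V, W, -, -, -, -, h⟩ := h
  obtain ⟨d', _, _, _, _, _, _, hd⟩ := exists_complement h
  simp at hd
  omega

section

variable {n : ℕ} {γ : Type} [Fintype γ] [DecidableEq γ] (b : Module.Basis γ k H)

/-- The coordinates of a matrix over `H` with respect to a basis of `H`. -/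
noncomputable def coords (s : Matrix (Fin n) (Fin n) H) : Fin n × Fin n × γ → k :=
  fun x ↦ b.coord x.2.2 (s x.1 x.2.1)

/-- Every endotrivial comodule has an open neighbourhood that is defined by the nonvanishing of
a polynomial, in which the isomorphism class is determined by a group-like element, among the
comodules with the same dimension of a maximal projective summand. -/
theorem MatEndotrivial.exists_polynomial {r : Matrix (Fin n) (Fin n) H} (hr : IsCorep k r)
    (hend : MatEndotrivial k r) {d : ℕ} (hd : HasProjSummand k r d) :
    ∃ φ : MvPolynomial (Fin n × Fin n × γ) k, MvPolynomial.eval (coords b r) φ ≠ 0 ∧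
      ∃ Q : H → Matrix (Fin n) (Fin n) H → Prop,
        (∀ s, IsCorep k s → MvPolynomial.eval (coords b s) φ ≠ 0 →
          ∃ w, IsGroupLikeElem k w ∧ Q w s) ∧
        ∀ w s t, IsCorep k s → IsCorep k t → Q w s → Q w t →
          (∀ d', HasProjSummand k s d' → d' ≤ d) → MatIso k s t := by
  have hend' := hend
  obtain ⟨m, q, -, -, V, W, hq, hq', -, -, hV, -, -, hWV, -, hm⟩ := hend'
  obtain ⟨R, X, Y, hR, hR', hX, -, hYX⟩ := hd
  -- Only the left factor of `S ⊗ M*` varies, so the coordinates of its matrix are linear in those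
  -- of `s`.
  obtain ⟨φ₁, h1, h1'⟩ := hq'.exists_polynomial b (I := Fin n × Fin n × γ)
    (x₀ := tensMat r (dualMat k r))
    (fun i j c ↦ ∑ e, MvPolynomial.X (i.1, j.1, e) *
      MvPolynomial.C (b.coord c (b e * dualMat k r i.2 j.2))) hq (coords b r)
    (by
      intro i j c
      conv_lhs => rw [tensMat, Matrix.kroneckerMap_apply, ← b.sum_repr (r i.1 j.1)]
      simp [coords, Finset.sum_mul, -Module.Basis.sum_repr]) hV hWV
  obtain ⟨φ₂, h2, h2'⟩ := hR'.exists_polynomial b (I := Fin n × Fin n × γ)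
    (fun i j c ↦ MvPolynomial.X (i, j, c)) hR (x₀ := r) (coords b r)
    (by simp [coords]) hX hYX
  -- The predicate records that `S ⊗ M*` is the sum of the character `w` and `q`, and that `R` is a
  -- summand of `S`. Neither `q` nor `R` depends on `s`.
  refine ⟨φ₁ * φ₂, by rw [map_mul, h1, h2]; simp, fun w s ↦
    (∃ (C : Matrix (Fin n × Fin n) (Fin 1) k) (D : Matrix (Fin 1) (Fin n × Fin n) k)
      (V : Matrix (Fin n × Fin n) (Fin m) k) (W : Matrix (Fin m) (Fin n × Fin n) k),
      Intertwines C (Matrix.of fun _ _ ↦ w) (tensMat s (dualMat k r)) ∧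
      Intertwines D (tensMat s (dualMat k r)) (Matrix.of fun _ _ ↦ w) ∧
      Intertwines V q (tensMat s (dualMat k r)) ∧ Intertwines W (tensMat s (dualMat k r)) q ∧
      D * C = 1 ∧ W * V = 1 ∧ C * D + V * W = 1 ∧ W * C = 0 ∧ D * V = 0) ∧
    ∃ (X : Matrix (Fin n) (Fin d) k) (Y : Matrix (Fin d) (Fin n) k),
      Intertwines X R s ∧ Intertwines Y s R ∧ Y * X = 1, ?_, ?_⟩
  · intro s hs hne
    rw [map_mul] at hne
    obtain ⟨V', W', hV', hW', hWV'⟩ := h1' (tensMat s (dualMat k r)) (coords b s)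
      (hs.tensor hr.dual)
      (by
        intro i j c
        conv_lhs => rw [tensMat, Matrix.kroneckerMap_apply, ← b.sum_repr (s i.1 j.1)]
        simp [coords, Finset.sum_mul, -Module.Basis.sum_repr]) (left_ne_zero_of_mul hne)
    obtain ⟨X', Y', hX', hY', hYX'⟩ := h2' s (coords b s) hs (by simp [coords])
      (right_ne_zero_of_mul hne)
    obtain ⟨w, hw, C, D, hC, hD, e1, e2, e3, e4⟩ := exists_groupLike (hs.tensor hr.dual) hV' hW'
      hWV' (by simpa using hm)
    exact ⟨w, hw, ⟨C, D, V', W', hC, hD, hV', hW', e1, hWV', e2, e3, e4⟩, X', Y', hX', hY', hYX'⟩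
  · rintro w s t hs ht ⟨⟨C, D, V, W, hC, hD, hV, hW, e1, e2, e3, e4, e5⟩, X, Y, hX, hY, hYX⟩
      ⟨⟨C', D', V', W', hC', hD', hV', hW', e1', e2', e3', e4', e5'⟩, X', Y', hX', hY', hYX'⟩ hmax
    -- Both `S ⊗ M*` and `T ⊗ M*` are identified with `w ⊕ q`; `A` and `B` are the resulting
    -- mutually inverse isomorphisms.
    obtain ⟨f, g, hf, hg, hgf⟩ := hend.exists_stable (s := s) ht (A := C' * D + V' * W)
      (B := C * D' + V * W') ((hC'.comp hD).add (hV'.comp hW)) ((hC.comp hD').add (hV.comp hW'))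
      (by
        have i1 : C * D' * (C' * D) = C * D := by
          rw [Matrix.mul_assoc, ← Matrix.mul_assoc D', e1', Matrix.one_mul]
        have i2 : C * D' * (V' * W) = 0 := by
          rw [Matrix.mul_assoc, ← Matrix.mul_assoc D', e5']; simp
        have i3 : V * W' * (C' * D) = 0 := by
          rw [Matrix.mul_assoc, ← Matrix.mul_assoc W', e4']; simp
        have i4 : V * W' * (V' * W) = V * W := by
          rw [Matrix.mul_assoc, ← Matrix.mul_assoc W', e2', Matrix.one_mul]
        rw [Matrix.add_mul, Matrix.mul_add, Matrix.mul_add, i1, i2, i3, i4, zero_add, add_zero,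
          e3])
    exact matIso_of_stable hs hf hg hgf hR hR' hX hY hYX hX' hY' hYX' (by simpa using hmax)

end

/-- There are only finitely many isomorphism classes of endotrivial comodules of dimension `n`,
in coordinates. -/
theorem finite_image_matEndotrivial [Module.Finite k H] {n : ℕ} {Q : Type*}
    (cls : Matrix (Fin n) (Fin n) H → Q)
    (hcls : ∀ s t, IsCorep k s → IsCorep k t → MatIso k s t → cls s = cls t) :
    (cls '' {s | IsCorep k s ∧ MatEndotrivial k s}).Finite := by
  classical
  let b := Module.finBasis k H
  -- Stratify by the exact dimension of a largest projective summand, since cancellation needs the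
  -- common summand to be maximal.
  let J : ℕ → Set (Matrix (Fin n) (Fin n) H) := fun d ↦ {s | IsCorep k s ∧ MatEndotrivial k s ∧
    HasProjSummand k s d ∧ ∀ d', HasProjSummand k s d' → d' ≤ d}
  have hJ : {s : Matrix (Fin n) (Fin n) H | IsCorep k s ∧ MatEndotrivial k s} ⊆
      ⋃ d ∈ Finset.range (n + 1), J d := by
    rintro s ⟨hs, hs'⟩
    have hle : ∀ d, HasProjSummand k s d → d ≤ n := fun d hd ↦ by simpa using hd.le
    let d := Nat.findGreatest (HasProjSummand k s) n
    have hd : HasProjSummand k s d := Nat.findGreatest_spec (Nat.zero_le n) (.zero s)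
    simp only [Set.mem_iUnion]
    exact ⟨d, by simpa [Nat.lt_succ_iff] using hle d hd, hs, hs', hd,
      fun d' hd' ↦ Nat.le_findGreatest (hle d' hd') hd'⟩
  refine Set.Finite.subset ?_ (Set.image_mono hJ)
  rw [Set.image_iUnion₂]
  refine Set.Finite.biUnion (Finset.finite_toSet _) fun d _ ↦ ?_
  choose φ h1 P h2 h3 using fun s : J d ↦ s.2.2.1.exists_polynomial b s.2.1 s.2.2.2.1
  obtain ⟨T, hT⟩ := exists_finite_subcover φ
  have hcov : cls '' J d ⊆ ⋃ i ∈ T, ⋃ w ∈ {w : H | IsGroupLikeElem k w},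
      cls '' {s | s ∈ J d ∧ P i w s} := by
    rintro _ ⟨s, hs, rfl⟩
    obtain ⟨i, hi, hne⟩ := hT (coords b s) ⟨s, hs⟩ (h1 ⟨s, hs⟩)
    obtain ⟨w, hw, hP⟩ := h2 i s hs.1 hne
    simp only [Set.mem_iUnion]
    exact ⟨i, hi, w, hw, s, ⟨hs, hP⟩, rfl⟩
  -- Within one neighbourhood of the finite subcover, each group-like element accounts for at most
  -- one isomorphism class.
  refine Set.Finite.subset (Set.Finite.biUnion (Finset.finite_toSet T) fun i _ ↦
    finite_isGroupLikeElem.biUnion fun w _ ↦ Set.Subsingleton.finite ?_) hcov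
  rintro _ ⟨s, ⟨hs, hsP⟩, rfl⟩ _ ⟨t, ⟨ht, htP⟩, rfl⟩
  exact hcls s t hs.1 ht.1 (h3 i w s t hs.1 ht.1 hsP htP hs.2.2.2)

/-! ### From comodules to coefficient matrices -/

section coefMat

variable {ι κ : Type} [Fintype ι] [Fintype κ] [DecidableEq ι] [DecidableEq κ]
  {M N : HopfComodule k H} (b : Module.Basis ι k M) (c : Module.Basis κ k N)

/-- The matrix of matrix coefficients with respect to a basis. -/
noncomputable def coefMat : Matrix ι ι H :=
  Matrix.of fun i j ↦ TensorProduct.lid k H ((b.coord i).rTensor H (M.coact (b j)))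

theorem eq_sum_basis_tmul {A V : Type*} [AddCommGroup V] [Module k V] [AddCommGroup A]
    [Module k A] (b : Module.Basis ι k V) (y : V ⊗[k] A) :
    y = ∑ i, b i ⊗ₜ[k] TensorProduct.lid k A ((b.coord i).rTensor A y) := by
  induction y with
  | zero => simp
  | add x y hx hy =>
    conv_lhs => rw [hx, hy]
    simp only [map_add, TensorProduct.tmul_add, Finset.sum_add_distrib]
  | tmul p q =>
    simp only [LinearMap.rTensor_tmul, TensorProduct.lid_tmul, ← TensorProduct.smul_tmul,
      ← TensorProduct.sum_tmul]
    simp [b.sum_repr]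

theorem lid_rTensor_coord_sum {A V : Type*} [AddCommGroup V] [Module k V] [AddCommGroup A]
    [Module k A] (b : Module.Basis ι k V) (x : ι → A) (i : ι) :
    TensorProduct.lid k A ((b.coord i).rTensor A (∑ l, b l ⊗ₜ[k] x l)) = x i := by
  simp [Finsupp.single_apply, TensorProduct.ite_tmul]

theorem sum_basis_tmul_inj {A V : Type*} [AddCommGroup V] [Module k V] [AddCommGroup A]
    [Module k A] (b : Module.Basis ι k V) {x y : ι → A}
    (h : ∑ l, b l ⊗ₜ[k] x l = ∑ l, b l ⊗ₜ[k] y l) : x = y := by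
  funext i
  rw [← lid_rTensor_coord_sum b x i, h, lid_rTensor_coord_sum]

theorem coact_basis (j : ι) : M.coact (b j) = ∑ i, b i ⊗ₜ[k] coefMat b i j :=
  eq_sum_basis_tmul b _

theorem coefMat_eq {r : Matrix ι ι H} (h : ∀ j, M.coact (b j) = ∑ i, b i ⊗ₜ[k] r i j) :
    coefMat b = r := by
  ext i j
  exact congrFun (sum_basis_tmul_inj b ((coact_basis b j).symm.trans (h j))) i

theorem isCorep_coefMat : IsCorep k (coefMat b) where
  comul i j := by
    have h := LinearMap.congr_fun M.coassoc (b j)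
    simp only [LinearMap.comp_apply, coact_basis, map_sum, LinearMap.rTensor_tmul,
      LinearMap.lTensor_tmul, LinearEquiv.coe_coe, TensorProduct.sum_tmul,
      TensorProduct.assoc_tmul] at h
    rw [Finset.sum_comm] at h
    simp only [← TensorProduct.tmul_sum] at h
    exact (congrFun (sum_basis_tmul_inj b h) i).symm
  counit i j := by
    have h := LinearMap.congr_fun M.counit_coact (b j)
    simp only [LinearMap.comp_apply, coact_basis, map_sum, LinearMap.lTensor_tmul,
      LinearEquiv.coe_coe, TensorProduct.rid_tmul, LinearMap.id_apply] at h
    have h' := congrArg (b.coord i) h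
    simpa [Finsupp.single_apply, Matrix.one_apply, eq_comm (a := j)] using h'

/-- Evaluate both sides on a basis vector and compare the coefficients in `H` along the basis of the
target. -/
theorem isHom_iff_intertwines (f : M →ₗ[k] N) :
    IsHom f ↔ Intertwines (LinearMap.toMatrix b c f) (coefMat b) (coefMat c) := by
  have hf : ∀ j, f (b j) = ∑ l, LinearMap.toMatrix b c f l j • c l := by
    intro j
    conv_lhs => rw [← c.sum_repr (f (b j))]
    simp [LinearMap.toMatrix_apply]
  generalize LinearMap.toMatrix b c f = F at *
  have h1 : ∀ j, N.coact (f (b j)) = ∑ i, c i ⊗ₜ[k] (coefMat c * baseMat H F) i j := by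
    intro j
    simp only [hf, map_sum, map_smul, coact_basis, Finset.smul_sum, ← TensorProduct.tmul_smul]
    rw [Finset.sum_comm]
    simp only [← TensorProduct.tmul_sum]
    refine Finset.sum_congr rfl fun i _ ↦ ?_
    simp [Matrix.mul_apply, Algebra.smul_def, mul_comm]
  have h2 : ∀ j, f.rTensor H (M.coact (b j)) = ∑ i, c i ⊗ₜ[k] (baseMat H F * coefMat b) i j := by
    intro j
    simp only [coact_basis, map_sum, LinearMap.rTensor_tmul, hf, TensorProduct.sum_tmul,
      TensorProduct.smul_tmul]
    rw [Finset.sum_comm]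
    simp only [← TensorProduct.tmul_sum]
    refine Finset.sum_congr rfl fun i _ ↦ ?_
    simp [Matrix.mul_apply, Algebra.smul_def]
  constructor
  · intro h
    ext i j
    have h3 := LinearMap.congr_fun h (b j)
    rw [LinearMap.comp_apply, LinearMap.comp_apply, h1, h2] at h3
    exact (congrFun (sum_basis_tmul_inj c h3) i).symm
  · intro h
    refine b.ext fun j ↦ ?_
    rw [LinearMap.comp_apply, LinearMap.comp_apply, h1, h2, h]

/-- The comodule with a given coefficient matrix. -/
noncomputable def ofMat (r : Matrix ι ι H) (hr : IsCorep k r) : HopfComodule k H where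
  carrier := ι → k
  coact := (Pi.basisFun k ι).constr k fun j ↦ ∑ i, Pi.basisFun k ι i ⊗ₜ[k] r i j
  coassoc := by
    refine (Pi.basisFun k ι).ext fun j ↦ ?_
    simp only [LinearMap.comp_apply, Module.Basis.constr_basis, map_sum, LinearMap.rTensor_tmul,
      LinearMap.lTensor_tmul, hr.comul, TensorProduct.sum_tmul, LinearEquiv.coe_coe,
      TensorProduct.assoc_tmul, TensorProduct.tmul_sum]
    rw [Finset.sum_comm]
  counit_coact := by
    refine (Pi.basisFun k ι).ext fun j ↦ ?_
    simp only [LinearMap.comp_apply, Module.Basis.constr_basis, map_sum,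
      LinearMap.lTensor_tmul, hr.counit, LinearEquiv.coe_coe,
      TensorProduct.rid_tmul, Matrix.one_apply, ite_smul, one_smul, zero_smul]
    simp

/-- The standard basis of `ofMat`. -/
noncomputable def ofMatBasis (r : Matrix ι ι H) (hr : IsCorep k r) :
    Module.Basis ι k (ofMat r hr) :=
  Pi.basisFun k ι

theorem coefMat_ofMatBasis (r : Matrix ι ι H) (hr : IsCorep k r) :
    coefMat (ofMatBasis r hr) = r :=
  coefMat_eq _ fun j ↦ (Pi.basisFun k ι).constr_basis k
    (fun j ↦ ∑ i, Pi.basisFun k ι i ⊗ₜ[k] r i j) j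

theorem isHom_toLin {F : Matrix κ ι k} (hF : Intertwines F (coefMat b) (coefMat c)) :
    IsHom (Matrix.toLin b c F) := by
  rwa [isHom_iff_intertwines b c, LinearMap.toMatrix_toLin]

theorem Iso.of_matIso (h : MatIso k (coefMat b) (coefMat c)) : Iso M N := by
  obtain ⟨A, B, hA, -, hBA, hAB⟩ := h
  exact ⟨LinearEquiv.ofLinearMap (Matrix.toLin b c A) (Matrix.toLin c b B)
    (by rw [← Matrix.toLin_mul, hAB, Matrix.toLin_one])
    (by rw [← Matrix.toLin_mul, hBA, Matrix.toLin_one]), isHom_toLin b c hA⟩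

theorem iso_ofMat : Iso M (ofMat (coefMat b) (isCorep_coefMat b)) := by
  refine Iso.of_matIso b (ofMatBasis _ (isCorep_coefMat b)) ?_
  rw [coefMat_ofMatBasis]
  exact ⟨1, 1, .one, .one, Matrix.mul_one _, Matrix.mul_one _⟩

/-- The matrix test objects are realised as comodules by `ofMat`; the matrix `G` witnesses
surjectivity. -/
theorem IsProjective.fProj (hM : IsProjective M) : FProj k (coefMat b) := by
  intro ρ σ _ _ _ _ r s F G φ hr hs hF hFG hφ
  rw [← coefMat_ofMatBasis r hr, ← coefMat_ofMatBasis s hs] at hF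
  rw [← coefMat_ofMatBasis s hs] at hφ
  let br := ofMatBasis r hr
  let bs := ofMatBasis s hs
  obtain ⟨g, hg, hfg⟩ := hM _ _ (Matrix.toLin br bs F) (Matrix.toLin b bs φ)
    (isHom_toLin br bs hF) (fun y ↦ ⟨Matrix.toLin bs br G y, by
      rw [← LinearMap.comp_apply, ← Matrix.toLin_mul, hFG, Matrix.toLin_one, LinearMap.id_apply]⟩)
    (isHom_toLin b bs hφ)
  refine ⟨LinearMap.toMatrix b br g, ?_, ?_⟩
  · have := (isHom_iff_intertwines b br g).1 hg
    rwa [coefMat_ofMatBasis] at this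
  · have := congrArg (LinearMap.toMatrix b bs) hfg
    rwa [LinearMap.toMatrix_comp b br bs, LinearMap.toMatrix_toLin, LinearMap.toMatrix_toLin]
      at this

/-- With matrix units as basis, `Hom(M, N)` is `N ⊗ M*`: the first index comes from `N`, and the
factor `S(m₁)` in the coaction yields the dual matrix. -/
theorem coefMat_hom [Module.Finite k M] :
    coefMat (M := hom M N) (b.linearMap c) = tensMat (coefMat c) (dualMat k (coefMat b)) := by
  refine coefMat_eq (M := hom M N) _ fun x ↦ ?_
  obtain ⟨a, i⟩ := x
  apply (homTensorEquiv M N H).injective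
  refine b.ext fun l ↦ ?_
  have h1 : (homTensorEquiv M N H) ((hom M N).coact (b.linearMap c (a, i))) =
      homCoactAux M N (b.linearMap c (a, i)) := LinearEquiv.apply_symm_apply _ _
  rw [h1, map_sum, LinearMap.sum_apply]
  simp only [homTensorEquiv_tmul, homCoactAux, LinearMap.coe_mk, AddHom.coe_mk,
    LinearMap.comp_apply, coact_basis, map_sum, LinearMap.rTensor_tmul,
    Module.Basis.linearMap_apply_apply, Fintype.sum_prod_type, TensorProduct.ite_tmul]
  simp [twist_tmul, coact_basis, dualMat, apply_ite N.twist]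

end coefMat

theorem coefMat_trivial :
    coefMat (M := trivial k H) (Module.Basis.singleton Unit k) = 1 := by
  refine coefMat_eq (M := trivial k H) _ fun j ↦ ?_
  simp [trivial]

section directSum

variable (M N : HopfComodule k H)

theorem isHom_inl : IsHom (M := M) (N := directSum M N) (LinearMap.inl k M N) :=
  LinearMap.coprod_inl _ _

theorem isHom_inr : IsHom (M := N) (N := directSum M N) (LinearMap.inr k M N) :=
  LinearMap.coprod_inr _ _

theorem isHom_fst : IsHom (M := directSum M N) (N := M) (LinearMap.fst k M N) := by
  refine LinearMap.prod_ext ?_ ?_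
  · rw [LinearMap.comp_assoc, LinearMap.comp_assoc, isHom_inl M N, ← LinearMap.comp_assoc M.coact,
      ← LinearMap.rTensor_comp, LinearMap.fst_comp_inl]
    simp
  · rw [LinearMap.comp_assoc, LinearMap.comp_assoc, isHom_inr M N, ← LinearMap.comp_assoc N.coact,
      ← LinearMap.rTensor_comp, LinearMap.fst_comp_inr]
    simp

theorem isHom_snd : IsHom (M := directSum M N) (N := N) (LinearMap.snd k M N) := by
  refine LinearMap.prod_ext ?_ ?_
  · rw [LinearMap.comp_assoc, LinearMap.comp_assoc, isHom_inl M N, ← LinearMap.comp_assoc M.coact,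
      ← LinearMap.rTensor_comp, LinearMap.snd_comp_inl]
    simp
  · rw [LinearMap.comp_assoc, LinearMap.comp_assoc, isHom_inr M N, ← LinearMap.comp_assoc N.coact,
      ← LinearMap.rTensor_comp, LinearMap.snd_comp_inr]
    simp

theorem IsHom.comp {M N P : HopfComodule k H} {g : N →ₗ[k] P} {f : M →ₗ[k] N} (hg : IsHom g)
    (hf : IsHom f) : IsHom (g ∘ₗ f) := by
  unfold IsHom at *
  rw [LinearMap.rTensor_comp, ← LinearMap.comp_assoc, hg, LinearMap.comp_assoc, hf,
    LinearMap.comp_assoc]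

theorem IsHom.symm {M N : HopfComodule k H} {e : M ≃ₗ[k] N} (he : IsHom e.toLinearMap) :
    IsHom e.symm.toLinearMap := by
  unfold IsHom at he ⊢
  have h : e.symm.toLinearMap.rTensor H ∘ₗ e.toLinearMap.rTensor H = LinearMap.id := by
    rw [← LinearMap.rTensor_comp]; simp
  calc M.coact ∘ₗ e.symm.toLinearMap
      = e.symm.toLinearMap.rTensor H ∘ₗ (e.toLinearMap.rTensor H ∘ₗ M.coact) ∘ₗ
          e.symm.toLinearMap := by
        rw [LinearMap.comp_assoc, ← LinearMap.comp_assoc, h, LinearMap.id_comp]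
    _ = e.symm.toLinearMap.rTensor H ∘ₗ N.coact := by
        rw [← he, LinearMap.comp_assoc]; simp

end directSum

theorem IsEndotrivial.matEndotrivial {M : HopfComodule k H} [Module.Finite k M]
    (h : M.IsEndotrivial) {n : ℕ} (b : Module.Basis (Fin n) k M) :
    MatEndotrivial k (coefMat b) := by
  obtain ⟨P, hP, hiso⟩ := h
  obtain ⟨e₀, he₀⟩ := hiso
  obtain ⟨e, he, hee⟩ : ∃ e : (M →ₗ[k] M) ≃ₗ[k] (k × P),
      IsHom (M := hom M M) (N := directSum (trivial k H) P) e.toLinearMap ∧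
      IsHom (M := directSum (trivial k H) P) (N := hom M M) e.symm.toLinearMap :=
    ⟨e₀, he₀, he₀.symm⟩
  -- No finiteness of `P` is assumed; it is a quotient of the finite-dimensional space `Hom(M, M)`.
  have : Module.Finite k P := Module.Finite.of_surjective
    (LinearMap.snd k k P ∘ₗ e.toLinearMap) (Prod.snd_surjective.comp e.surjective)
  let c := Module.finBasis k P
  let B : Module.Basis (Fin n × Fin n) k (M →ₗ[k] M) := b.linearMap b
  let u : Module.Basis Unit k k := Module.Basis.singleton Unit k
  have hi := (isHom_iff_intertwines (M := trivial k H) (N := hom M M) u B _).1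
    (hee.comp (isHom_inl (trivial k H) P))
  have hj := (isHom_iff_intertwines (M := hom M M) (N := trivial k H) B u _).1
    ((isHom_fst (trivial k H) P).comp he)
  have hV := (isHom_iff_intertwines (M := P) (N := hom M M) c B _).1
    (hee.comp (isHom_inr (trivial k H) P))
  have hW := (isHom_iff_intertwines (M := hom M M) (N := P) B c _).1
    ((isHom_snd (trivial k H) P).comp he)
  rw [coefMat_trivial, coefMat_hom] at hi hj
  rw [coefMat_hom] at hV hW
  refine ⟨_, coefMat c, _, _, _, _, isCorep_coefMat c, hP.fProj c, hi, hj, hV, hW, ?_, ?_, ?_, ?_⟩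
  · rw [← LinearMap.toMatrix_comp, ← LinearMap.toMatrix_id u]
    congr 1
    ext
    simp
  · rw [← LinearMap.toMatrix_comp, ← LinearMap.toMatrix_id c]
    congr 1
    ext
    simp
  · rw [← LinearMap.toMatrix_comp, ← LinearMap.toMatrix_comp, ← map_add, ← LinearMap.toMatrix_id B]
    congr 1
    refine LinearMap.ext fun x ↦ e.injective ?_
    simp
  · rw [← Module.finrank_eq_card_basis B, e.finrank_eq, Module.finrank_prod, Module.finrank_self]

/-- There are only finitely many isomorphism classes of endotrivial comodules of dimension `n`
over a finite-dimensional commutative Hopf algebra. -/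
theorem finite_isoClass_isEndotrivial [Module.Finite k H] (n : ℕ) :
    {c : IsoClass k H | ∃ (M : HopfComodule k H) (_ : Module.Finite k M),
      Module.finrank k M = n ∧ M.IsEndotrivial ∧ isoClass M = c}.Finite := by
  classical
  -- The trivial comodule is only a default value for matrices that are not corepresentations.
  let cls : Matrix (Fin n) (Fin n) H → IsoClass k H := fun s ↦
    if hs : IsCorep k s then isoClass (ofMat s hs) else isoClass (trivial k H)
  refine (finite_image_matEndotrivial (k := k) cls ?_).subset ?_
  · intro s t hs ht hst
    simp only [cls, dif_pos hs, dif_pos ht]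
    refine Quotient.sound (Iso.of_matIso (ofMatBasis s hs) (ofMatBasis t ht) ?_)
    rwa [coefMat_ofMatBasis, coefMat_ofMatBasis]
  · rintro _ ⟨M, _, hn, hM, rfl⟩
    let b := Module.finBasisOfFinrankEq k M hn
    refine ⟨coefMat b, ⟨isCorep_coefMat b, hM.matEndotrivial b⟩, ?_⟩
    simp only [cls, dif_pos (isCorep_coefMat b)]
    exact Quotient.sound (iso_ofMat b).symm

end HopfComodule

/-! ### Passage to finite group schemes -/

section

open AlgebraicGeometry CategoryTheory

/-- The scheme is affine, so its structure morphism becomes `Spec` of the ring map from `k` to the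
coordinate ring, and finiteness of the morphism is finiteness of that map. -/
theorem FiniteGroupScheme.finite_coordinateRing {k : Type u} [Field k]
    (S : FiniteGroupScheme k) : Module.Finite k S.CoordinateRing := by
  have h : IsFinite (S.scheme.isoSpec.inv ≫ (S.scheme ↘ Spec (CommRingCat.of k))) := inferInstance
  have h' : Spec.map (Spec.fullyFaithful.preimage <|
      S.scheme.isoSpec.inv ≫ S.scheme ↘ Spec (CommRingCat.of k)).unop =
      S.scheme.isoSpec.inv ≫ (S.scheme ↘ Spec (CommRingCat.of k)) :=
    Spec.fullyFaithful.map_preimage _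
  rw [← h', IsFinite.SpecMap_iff] at h
  rw [← RingHom.finite_algebraMap]
  exact h

end

theorem mainTheorem1 {k : Type u} [Field k] [IsAlgClosed k] (S : FiniteGroupScheme k) (n : ℕ) :
    {c : HopfComodule.IsoClass k S.CoordinateRing |
      ∃ (M : S.Rep) (_ : Module.Finite k M),
        Module.finrank k M = n ∧ M.IsEndotrivial ∧ HopfComodule.isoClass M = c}.Finite := by
  have := S.finite_coordinateRing
  exact HopfComodule.finite_isoClass_isEndotrivial n
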